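/- Let $\alpha>0$ and $b\in\mathbb R\setminus\{0\}$. In coordinates $(t,\rho,\theta,\varphi)$, $\rho>0$, covering the interior of the cosmological horizon of de Sitter spacetime (the horizon is $\rho\to\infty$), let $$g=\frac{-dt^2+d\rho^2}{\cosh^2(\alpha\rho)}+\alpha^{-2}\tanh^2(\alpha\rho)\,(d\theta^2+\sin^2\theta\,d\varphi^2).$$ Let $\upsilon\in(0,2\pi)$ be given by $\sin\upsilon=\frac{2b\alpha}{1+b^2\alpha^2}$, $\cos\upsilon=\frac{1-b^2\alpha^2}{1+b^2\alpha^2}$, and put $N=\cosh(\alpha\rho)-\cosh(\alpha t-i\upsilon)$, $$\chi=\frac{\alpha^2\sinh^2(\alpha\rho)}{(1+b^2\alpha^2)^2N^2}.$$ The $l=1$ hopfion-like Maxwell field is $$\mathcal F_H=e^{i\varphi}\Big\{2\chi\sin\theta\Big(\tfrac{\alpha^2}{\sinh^2(\alpha\rho)}dt\wedge d\rho+i\sin\theta\,d\theta\wedge d\varphi\Big)-(\partial_t\chi-\partial_\rho\chi\cos\theta)(dt\wedge d\theta-i\sin\theta\,d\rho\wedge d\varphi)-(\partial_\rho\chi-\partial_t\chi\cos\theta)(d\rho\wedge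 d\theta-i\sin\theta\,dt\wedge d\varphi)\Big\}.$$ Let $I=\cosh(\alpha\rho)+\cosh(\alpha t)$, $\cosh u=\frac{1+\cosh(\alpha\rho)\cosh(\alpha t)}{I}$, $\sinh u=\frac{\sinh(\alpha\rho)\sinh(\alpha t)}{I}$, $M=\sin\upsilon\cosh(\alpha\rho)+2i\cos\frac\upsilon2\sinh(\alpha t-\frac{i\upsilon}2)$, $D_1=NM^2$, $D_2=N^2M$, and $$\begin{aligned}\mathcal A_H=&-\frac{\alpha^3I^2e^{i\varphi}\sin\theta}{D_1(1+\alpha^2b^2)^2}\Big\{\Big[i\sin\upsilon\sinh u+(1+\cos\upsilon)\Big(\tfrac{\sinh(\alpha\rho)\cosh u}{I}-\alpha^{-1}\partial_\rho(\cosh u)\Big)\Big]dt\\&\qquad+\Big[-i\sin\upsilon\cosh u+(1+\cos\upsilon)\Big(\tfrac{\sinh(\alpha t)\cosh u}{I}-\alpha^{-1}\partial_t(\cosh u)\Big)\Big]d\rho\Big\}\\&-\frac{\alpha^2e^{i\varphi}\sinh(\alpha\rho)}{D_2(1+\alpha^2b^2)^2}\Big\{\big(I(\cosh u-\cosh(\alpha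 t-i\upsilon))-\cos\upsilon\sinh^2(\alpha\rho)\big)(\sin\theta\,d\varphi-i\cos\theta\,d\theta)\\&\qquad+\sinh(\alpha\rho)\big(\cosh(\alpha\rho)\sin\upsilon+i(\sinh(\alpha t)+\sinh(\alpha t-i\upsilon))\big)(d\theta+i\sin\theta\cos\theta\,d\varphi)\Big\}.\end{aligned}$$ Write $\mathcal F_H=F+iG$, $\mathcal A_H=A+iC$ with real $F,G,A,C$. (The electric and magnetic fields are proportional to $F^{ti}$ and $G^{ti}$, so that in flat space the helicity density below is $(\mathbf A\cdot\mathbf B-\mathbf C\cdot\mathbf E)/8\pi$.) The helicity current is the vector density $$\mathcal C^\mu=\tfrac1{8\pi}\sqrt{|\det g|}\,\big(G^{\mu\nu}A_\nu-F^{\mu\nu}C_\nu\big)=\tfrac1{8\pi}\sqrt{|\det g|}\;\Im\big(\mathcal F_H^{\mu\nu}\,\overline{(\mathcal A_H)_\nu}\big),$$ and the total helicity inside the horizon is $H(t)=\int_0^\infty d\rho\int_0^\pi d\theta\int_0^{2\pi}d\varphi\;\mathcal C^t$. Then: 1. $\mathcal A_H$ is smooth for $\rho>0$, $0<\theta<\pi$,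 and $d\mathcal A_H=\mathcal F_H$ there. 2. For every $t$ the density $\mathcal C^t$ is integrable over $(0,\infty)\times(0,\pi)\times(0,2\pi)$ and $$H(t)=\frac{\alpha^4b^4\arctan\frac1{\alpha b}+2b^2\alpha^2\arctan\frac1{\alpha b}-b^3\alpha^3+\arctan\frac1{\alpha b}+\alpha b}{8b^4(b^2\alpha^2+1)^2};$$ in particular $H$ does not depend on $t$: $dH/dt=0$. 3. The helicity flux through the cosmological horizon vanishes: for every $t$, $\mathcal C^\rho$ is integrable over every sphere $\rho=\mathrm{const}>0$, and $$\lim_{\rho\to\infty}\Big(-\int_0^\pi d\theta\int_0^{2\pi}d\varphi\;\mathcal C^\rho(t,\rho,\theta,\varphi)\Big)=0.$$ 4. For every fixed $t$, as $\alpha\to0^+$, $H\to\dfrac{\pi\,\operatorname{sign}(b)}{16\,b^4}$, and more precisely $H=\dfrac{\pi\,\operatorname{sign}(b)}{16\,b^4}+O(\alpha^3)$. -/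

import Mathlib

open Real Set Filter Topology MeasureTheory Asymptotics
open scoped ContDiff

noncomputable section

namespace DeSitterHopfion

/-! Coordinates `x = (t, ρ, θ, φ)` on the region of de Sitter spacetime inside the cosmological
horizon are indexed by `Fin 4`; the horizon `r = 1/α` corresponds to `ρ → ∞`, where
`r = tanh (α ρ) / α`. -/

/-- The coordinate domain `ρ > 0`, `0 < θ < π`. -/
def chart : Set (Fin 4 → ℝ) := {x | 0 < x 1 ∧ 0 < x 2 ∧ x 2 < π}

/-- `g = - dt² / cosh² (α ρ) + dρ² / cosh² (α ρ) + α⁻² tanh² (α ρ) (dθ² + sin² θ dφ²)`. -/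
def metric (α : ℝ) (x : Fin 4 → ℝ) : Matrix (Fin 4) (Fin 4) ℝ :=
  Matrix.diagonal ![-1 / cosh (α * x 1) ^ 2, 1 / cosh (α * x 1) ^ 2,
    tanh (α * x 1) ^ 2 / α ^ 2, tanh (α * x 1) ^ 2 / α ^ 2 * sin (x 2) ^ 2]

/-- `√|det g|`. -/
def volumeFactor (α : ℝ) (x : Fin 4 → ℝ) : ℝ := √|(metric α x).det|

/-- `W^{μν} = g^{μκ} g^{νλ} W_{κλ}`. -/
def raise (α : ℝ) (x : Fin 4 → ℝ) (W : Matrix (Fin 4) (Fin 4) ℂ) (μ ν : Fin 4) : ℂ :=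
  ∑ κ, ∑ l, (((metric α x)⁻¹ μ κ * (metric α x)⁻¹ ν l : ℝ) : ℂ) * W κ l

/-- The partial derivative `∂_μ f`. -/
def partialDeriv (μ : Fin 4) (f : (Fin 4 → ℝ) → ℂ) (x : Fin 4 → ℝ) : ℂ :=
  deriv (fun s : ℝ => f (Function.update x μ s)) (x μ)

/-- The exterior derivative of a one-form, `(d𝓐)_{μν} = ∂_μ 𝓐_ν - ∂_ν 𝓐_μ`. -/
def extD (A : (Fin 4 → ℝ) → Fin 4 → ℂ) (x : Fin 4 → ℝ) : Matrix (Fin 4) (Fin 4) ℂ :=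
  fun μ ν => partialDeriv μ (fun y => A y ν) x - partialDeriv ν (fun y => A y μ) x

/-- The angle `υ ∈ (0, 2π)` with `sin υ = 2 b α / (1 + b² α²)` and
`cos υ = (1 - b² α²) / (1 + b² α²)`; see `upsilon_spec`. -/
def upsilon (α b : ℝ) : ℝ := π - 2 * arctan (1 / (α * b))

theorem upsilon_spec (α b : ℝ) (h : α * b ≠ 0) :
    0 < upsilon α b ∧ upsilon α b < 2 * π ∧
      sin (upsilon α b) = 2 * b * α / (1 + b ^ 2 * α ^ 2) ∧
      cos (upsilon α b) = (1 - b ^ 2 * α ^ 2) / (1 + b ^ 2 * α ^ 2) := by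
  have h1 := arctan_lt_pi_div_two (1 / (α * b))
  have h2 := neg_pi_div_two_lt_arctan (1 / (α * b))
  have hα : α ≠ 0 := left_ne_zero_of_mul h
  have hb : b ≠ 0 := right_ne_zero_of_mul h
  have hc : cos (arctan (1 / (α * b))) ^ 2 = 1 / (1 + (1 / (α * b)) ^ 2) := cos_sq_arctan _
  have hs : sin (arctan (1 / (α * b))) = 1 / (α * b) * cos (arctan (1 / (α * b))) := by
    have h3 : tan (arctan (1 / (α * b))) = 1 / (α * b) := tan_arctan _
    have h4 : cos (arctan (1 / (α * b))) ≠ 0 := (cos_arctan_pos _).ne'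
    rw [tan_eq_sin_div_cos, div_eq_iff h4] at h3
    exact h3
  have hp : 1 + b ^ 2 * α ^ 2 ≠ 0 := by positivity
  have hq : 1 + (1 / (α * b)) ^ 2 ≠ 0 := by positivity
  refine ⟨by unfold upsilon; linarith, by unfold upsilon; linarith, ?_, ?_⟩
  · rw [upsilon, sin_pi_sub, sin_two_mul, hs,
      show 2 * (1 / (α * b) * cos (arctan (1 / (α * b)))) * cos (arctan (1 / (α * b)))
        = 2 / (α * b) * cos (arctan (1 / (α * b))) ^ 2 by ring, hc]
    field_simp
    ring
  · rw [upsilon, cos_pi_sub, cos_two_mul, hc]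
    field_simp
    ring

/-- `N = cosh (α ρ) - cosh (α t - i υ)`. -/
def nFun (α b t ρ : ℝ) : ℂ :=
  Complex.cosh (α * ρ) - Complex.cosh (α * t - Complex.I * upsilon α b)

/-- `χ = α² sinh² (α ρ) / ((1 + b² α²)² (cosh (α ρ) - cosh (α t - i υ))²)`. -/
def chi (α b t ρ : ℝ) : ℂ :=
  (α : ℂ) ^ 2 * Complex.sinh (α * ρ) ^ 2 / ((1 + (b : ℂ) ^ 2 * α ^ 2) ^ 2 * nFun α b t ρ ^ 2)

/-- `∂_t χ`. -/
def chiT (α b t ρ : ℝ) : ℂ := deriv (fun s : ℝ => chi α b s ρ) t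

/-- `∂_ρ χ`. -/
def chiR (α b t ρ : ℝ) : ℂ := deriv (fun s : ℝ => chi α b t s) ρ

/-- The two-form `dx^μ ∧ dx^ν`. -/
def wedge (μ ν : Fin 4) : Matrix (Fin 4) (Fin 4) ℂ :=
  Matrix.single μ ν 1 - Matrix.single ν μ 1

/-- The complex Maxwell two-form `𝓕_H` of the hopfion-like solution with `l = 1`. -/
def hopfionF (α b : ℝ) (x : Fin 4 → ℝ) : Matrix (Fin 4) (Fin 4) ℂ :=
  let χ := chi α b (x 0) (x 1)
  let χt := chiT α b (x 0) (x 1)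
  let χr := chiR α b (x 0) (x 1)
  let S : ℂ := Complex.sin (x 2)
  let C : ℂ := Complex.cos (x 2)
  Complex.exp (Complex.I * x 3) •
    ((2 * χ * S) • (((α : ℂ) ^ 2 / Complex.sinh (α * x 1) ^ 2) • wedge 0 1
        + (Complex.I * S) • wedge 2 3)
      - (χt - χr * C) • (wedge 0 2 - (Complex.I * S) • wedge 1 3)
      - (χr - χt * C) • (wedge 1 2 - (Complex.I * S) • wedge 0 3))

/-- `I = cosh (α ρ) + cosh (α t)`. -/
def sumCosh (α t ρ : ℝ) : ℝ := cosh (α * ρ) + cosh (α * t)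

/-- `cosh u`, where `u = u (t, ρ)`. -/
def coshU (α t ρ : ℝ) : ℝ := (1 + cosh (α * ρ) * cosh (α * t)) / sumCosh α t ρ

/-- `sinh u`, where `u = u (t, ρ)`. -/
def sinhU (α t ρ : ℝ) : ℝ := sinh (α * ρ) * sinh (α * t) / sumCosh α t ρ

/-- `M = sin υ cosh (α ρ) + 2 i cos (υ / 2) sinh (α t - i υ / 2)`. -/
def mFun (α b t ρ : ℝ) : ℂ :=
  Complex.sin (upsilon α b) * Complex.cosh (α * ρ)
    + 2 * Complex.I * Complex.cos (upsilon α b / 2)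
      * Complex.sinh (α * t - Complex.I * upsilon α b / 2)

/-- `D₁ = N M²`. -/
def D1 (α b t ρ : ℝ) : ℂ := nFun α b t ρ * mFun α b t ρ ^ 2

/-- `D₂ = N² M`. -/
def D2 (α b t ρ : ℝ) : ℂ := nFun α b t ρ ^ 2 * mFun α b t ρ

/-- The common factor of the `dt` and `dρ` components of the potential. -/
def factor1 (α b : ℝ) (x : Fin 4 → ℝ) : ℂ :=
  -((α : ℂ) ^ 3 * (sumCosh α (x 0) (x 1) : ℂ) ^ 2 * Complex.exp (Complex.I * x 3)
      * Complex.sin (x 2))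
    / (D1 α b (x 0) (x 1) * (1 + (α : ℂ) ^ 2 * b ^ 2) ^ 2)

/-- The common factor of the `dθ` and `dφ` components of the potential. -/
def factor2 (α b : ℝ) (x : Fin 4 → ℝ) : ℂ :=
  -((α : ℂ) ^ 2 * Complex.exp (Complex.I * x 3) * Complex.sinh (α * x 1))
    / (D2 α b (x 0) (x 1) * (1 + (α : ℂ) ^ 2 * b ^ 2) ^ 2)

/-- The bracket multiplying `dt`. -/
def bracketT (α b t ρ : ℝ) : ℂ :=
  Complex.I * Complex.sin (upsilon α b) * sinhU α t ρ
    + (1 + Complex.cos (upsilon α b))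
      * ((sinh (α * ρ) * coshU α t ρ / sumCosh α t ρ
          - α⁻¹ * deriv (fun s => coshU α t s) ρ : ℝ) : ℂ)

/-- The bracket multiplying `dρ`. -/
def bracketR (α b t ρ : ℝ) : ℂ :=
  -Complex.I * Complex.sin (upsilon α b) * coshU α t ρ
    + (1 + Complex.cos (upsilon α b))
      * ((sinh (α * t) * coshU α t ρ / sumCosh α t ρ
          - α⁻¹ * deriv (fun s => coshU α s ρ) t : ℝ) : ℂ)

/-- The coefficient of `sin θ dφ - i cos θ dθ`. -/
def bracketX (α b t ρ : ℝ) : ℂ :=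
  sumCosh α t ρ * (coshU α t ρ - Complex.cosh (α * t - Complex.I * upsilon α b))
    - Complex.cos (upsilon α b) * Complex.sinh (α * ρ) ^ 2

/-- The coefficient of `dθ + i sin θ cos θ dφ`. -/
def bracketY (α b t ρ : ℝ) : ℂ :=
  Complex.sinh (α * ρ) * (Complex.cosh (α * ρ) * Complex.sin (upsilon α b)
    + Complex.I * (Complex.sinh (α * t) + Complex.sinh (α * t - Complex.I * upsilon α b)))

/-- The potential one-form `𝓐_H`. -/
def hopfionA (α b : ℝ) (x : Fin 4 → ℝ) : Fin 4 → ℂ :=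
  let S : ℂ := Complex.sin (x 2)
  let C : ℂ := Complex.cos (x 2)
  let X := bracketX α b (x 0) (x 1)
  let Y := bracketY α b (x 0) (x 1)
  ![factor1 α b x * bracketT α b (x 0) (x 1),
    factor1 α b x * bracketR α b (x 0) (x 1),
    factor2 α b x * (X * (-Complex.I * C) + Y),
    factor2 α b x * (X * S + Y * (Complex.I * S * C))]

/-- The helicity current (a vector density)
`(1 / 8π) √|det g| (G^{μν} A_ν - F^{μν} C_ν)` of the complex field `F + i G` with the complex
potential `A + i C`. The electric and magnetic fields are `E^i ∝ F^{ti}` and `B^i ∝ G^{ti}`, that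
is, the field is the one with Riemann-Silberstein vector `E + i B`, and in flat spacetime the time
component of the current is `(A · B - C · E) / 8π`. -/
def helicityCurrent (α : ℝ) (F : (Fin 4 → ℝ) → Matrix (Fin 4) (Fin 4) ℂ)
    (A : (Fin 4 → ℝ) → Fin 4 → ℂ) (x : Fin 4 → ℝ) (μ : Fin 4) : ℝ :=
  1 / (8 * π) * volumeFactor α x *
    ∑ ν, ((raise α x (F x) μ ν).im * (A x ν).re - (raise α x (F x) μ ν).re * (A x ν).im)

/-- The helicity current of the hopfion-like solution. -/
def hopfionCurrent (α b t ρ θ φ : ℝ) (μ : Fin 4) : ℝ :=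
  helicityCurrent α (hopfionF α b) (hopfionA α b) ![t, ρ, θ, φ] μ

/-- The total helicity at time `t` inside the cosmological horizon. -/
def totalHelicity (α b t : ℝ) : ℝ :=
  ∫ ρ in Ioi (0 : ℝ), ∫ θ in (0 : ℝ)..π, ∫ φ in (0 : ℝ)..(2 * π), hopfionCurrent α b t ρ θ φ 0

/-- The helicity flux into the ball bounded by the sphere of radius `ρ`, at time `t`. -/
def helicityFlux (α b t ρ : ℝ) : ℝ :=
  -∫ θ in (0 : ℝ)..π, ∫ φ in (0 : ℝ)..(2 * π), hopfionCurrent α b t ρ θ φ 1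

/-- The closed form of the total helicity. -/
def helicityValue (α b : ℝ) : ℝ :=
  (α ^ 4 * b ^ 4 * arctan (1 / (α * b)) + 2 * b ^ 2 * α ^ 2 * arctan (1 / (α * b))
      - b ^ 3 * α ^ 3 + arctan (1 / (α * b)) + α * b)
    / (8 * b ^ 4 * (b ^ 2 * α ^ 2 + 1) ^ 2)

end DeSitterHopfion

end

/-! The argument transports everything to flat space. Put X = sinh(αρ)/I and Y = sinh(αt)/I, so that
Y ± X = tanh(α(t ± ρ)/2). This change of variables preserves the null directions: dX = α(J dρ - XY
dt) and dY = α(J dt - XY dρ), with J = (1 - X² - Y²)/2. With q = bα and m = q + iY, the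
transcendental functions become rational: N is proportional to I(X² + m²), M to I m, and χ = α²
X²/(X² + m²)² (`nFun_eq`, `mFun_eq`, `chi_eq`). The potential becomes a flat one, built from a
one-form a_X dX + a_Y dY and two scalars f and χ. Since X² + m² factors into null pieces q + i(Y ±
X), no denominator vanishes, which gives smoothness.

The equation d𝓐 = 𝓕 reduces to two facts. First, df = i(a + ∗dχ), where ∗ exchanges the dX and dY
coefficients and commutes with the change of variables (`hasDerivAt_flatF`). Second, the curl of a
is 2χ/X² in flat terms; it is multiplied by the Jacobian determinant α²/I²
(`deriv_potR_sub_deriv_potT`).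

For the helicity, the phase e^{iφ} cancels and integration over the sphere removes the terms odd in
cos θ. The remaining radial density is an exact derivative of a function of (X, Y): d Re(χ f̄)
accounts for all of it except a multiple of Im(χ̄ ∂χ). That current is conserved because χ solves a
radial wave equation with a real potential, and `waveCharge` is an explicit primitive of it. The
sum, `flatHelicity`, vanishes at X = 0. Every slice of constant t tends to the same point (X, Y) =
(1, 0) at the horizon, so the total is α⁴ times the value there, whatever t is (`totalHelicity_eq`).
The flux vanishes because each current component is a continuous combination of J and XY, both of
which decay like e^{-αρ}.

The flat limit follows from arctan(1/x) = (π/2) sign x - arctan x: the terms linear in αb cancel and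
leave a cubic remainder. -/

namespace DeSitterHopfion

noncomputable section

/-! ### The conformal map to flat coordinates. -/

/-- The conformally flat radial coordinate. -/
def flatR (α t ρ : ℝ) : ℝ := sinh (α * ρ) / sumCosh α t ρ

/-- The conformally flat time coordinate. -/
def flatT (α t ρ : ℝ) : ℝ := sinh (α * t) / sumCosh α t ρ

/-- The diagonal entry `(1 - X² - Y²) / 2` of the conformal Jacobian. -/
def jac (X Y : ℝ) : ℝ := (1 - X ^ 2 - Y ^ 2) / 2

theorem sumCosh_pos (α t ρ : ℝ) : 0 < sumCosh α t ρ :=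
  add_pos (cosh_pos _) (cosh_pos _)

theorem jac_flat (α t ρ : ℝ) : jac (flatR α t ρ) (flatT α t ρ)
    = (1 + cosh (α * ρ) * cosh (α * t)) / sumCosh α t ρ ^ 2 := by
  have h := (sumCosh_pos α t ρ).ne'
  have h1 := cosh_sq (α * ρ)
  have h2 := cosh_sq (α * t)
  unfold jac flatR flatT
  field_simp
  unfold sumCosh
  linear_combination h1 + h2

/-- Up to α², this is the Jacobian determinant. It factors as (1 - (Y+X)²)(1 - (Y-X)²)/4, and Y ± X
= tanh(α(t ± ρ)/2) while I is twice the product of the two half-argument hyperbolic cosines. -/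
theorem jac_sq_sub (α t ρ : ℝ) : jac (flatR α t ρ) (flatT α t ρ) ^ 2
    - (flatR α t ρ * flatT α t ρ) ^ 2 = 1 / sumCosh α t ρ ^ 2 := by
  have h := (sumCosh_pos α t ρ).ne'
  have h1 := cosh_sq (α * ρ)
  have h2 := cosh_sq (α * t)
  rw [jac_flat]
  unfold flatR flatT
  field_simp
  rw [show sinh (α * ρ) ^ 2 = cosh (α * ρ) ^ 2 - 1 by linarith,
    show sinh (α * t) ^ 2 = cosh (α * t) ^ 2 - 1 by linarith]
  unfold sumCosh
  ring

theorem hasDerivAt_cosh_mul (α s : ℝ) :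
    HasDerivAt (fun s => cosh (α * s)) (α * sinh (α * s)) s := by
  have := ((hasDerivAt_id s).const_mul α).cosh
  simpa [mul_comm] using this

theorem hasDerivAt_sinh_mul (α s : ℝ) :
    HasDerivAt (fun s => sinh (α * s)) (α * cosh (α * s)) s := by
  have := ((hasDerivAt_id s).const_mul α).sinh
  simpa [mul_comm] using this

theorem hasDerivAt_sumCosh_rho (α t ρ : ℝ) :
    HasDerivAt (fun s => sumCosh α t s) (α * sinh (α * ρ)) ρ :=
  (hasDerivAt_cosh_mul α ρ).add_const _

theorem hasDerivAt_sumCosh_t (α t ρ : ℝ) :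
    HasDerivAt (fun s => sumCosh α s ρ) (α * sinh (α * t)) t :=
  (hasDerivAt_cosh_mul α t).const_add _

/-- This and the next three lemmas give the Jacobian matrix. It has equal diagonal entries αJ and
equal off-diagonal entries -αXY, which is conformality in two dimensions. -/
theorem hasDerivAt_flatR_rho (α t ρ : ℝ) :
    HasDerivAt (fun s => flatR α t s) (α * jac (flatR α t ρ) (flatT α t ρ)) ρ := by
  have h := (sumCosh_pos α t ρ).ne'
  refine ((hasDerivAt_sinh_mul α ρ).div (hasDerivAt_sumCosh_rho α t ρ) h).congr_deriv ?_
  rw [jac_flat]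
  field_simp
  unfold sumCosh
  linear_combination α * cosh_sq (α * ρ)

theorem hasDerivAt_flatT_t (α t ρ : ℝ) :
    HasDerivAt (fun s => flatT α s ρ) (α * jac (flatR α t ρ) (flatT α t ρ)) t := by
  have h := (sumCosh_pos α t ρ).ne'
  refine ((hasDerivAt_sinh_mul α t).div (hasDerivAt_sumCosh_t α t ρ) h).congr_deriv ?_
  rw [jac_flat]
  field_simp
  unfold sumCosh
  linear_combination α * cosh_sq (α * t)

theorem hasDerivAt_flatR_t (α t ρ : ℝ) :
    HasDerivAt (fun s => flatR α s ρ) (-(α * (flatR α t ρ * flatT α t ρ))) t := by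
  have h := (sumCosh_pos α t ρ).ne'
  refine ((hasDerivAt_const t (sinh (α * ρ))).div (hasDerivAt_sumCosh_t α t ρ) h).congr_deriv ?_
  unfold flatR flatT
  field_simp
  ring

theorem hasDerivAt_flatT_rho (α t ρ : ℝ) :
    HasDerivAt (fun s => flatT α t s) (-(α * (flatR α t ρ * flatT α t ρ))) ρ := by
  have h := (sumCosh_pos α t ρ).ne'
  refine ((hasDerivAt_const ρ (sinh (α * t))).div (hasDerivAt_sumCosh_rho α t ρ) h).congr_deriv ?_
  unfold flatR flatT
  field_simp
  ring

/-! ### The flat potentials -/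

/-- The complexified time `q + i Y`. -/
def cTime (q Y : ℝ) : ℂ := q + Complex.I * Y

/-- The complexified interval `X² + (q + i Y)²`. -/
def cInt (q X Y : ℝ) : ℂ := X ^ 2 + cTime q Y ^ 2

/-- The flat generating function. -/
def flatChi (q X Y : ℝ) : ℂ := X ^ 2 / cInt q X Y ^ 2

/-- The flat angular potential. -/
def flatF (q X Y : ℝ) : ℂ :=
  -(X * (cTime q Y ^ 2 - X ^ 2)) / (2 * cInt q X Y ^ 2 * cTime q Y)

/-- The radial component of the flat potential. -/
def flatAX (q X Y : ℝ) : ℂ := Complex.I / (2 * cInt q X Y * cTime q Y)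

/-- The time component of the flat potential. -/
def flatAY (q X Y : ℝ) : ℂ := -X / (2 * cInt q X Y * cTime q Y ^ 2)

theorem cTime_ne_zero {q : ℝ} (hq : q ≠ 0) (Y : ℝ) : cTime q Y ≠ 0 := by
  intro h
  apply hq
  simpa [cTime] using congrArg Complex.re h

/-- In null form each factor has real part q, so a nonzero q keeps the singularities off the real
spacetime. -/
theorem cInt_eq_mul (q X Y : ℝ) : cInt q X Y = cTime q (Y + X) * cTime q (Y - X) := by
  unfold cInt cTime
  push_cast
  linear_combination (X : ℂ) ^ 2 * Complex.I_sq

theorem cInt_ne_zero {q : ℝ} (hq : q ≠ 0) (X Y : ℝ) : cInt q X Y ≠ 0 := by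
  rw [cInt_eq_mul]
  exact mul_ne_zero (cTime_ne_zero hq _) (cTime_ne_zero hq _)

/-- `∂_X χ`. -/
def flatChiX (q X Y : ℝ) : ℂ := 2 * X * (cTime q Y ^ 2 - X ^ 2) / cInt q X Y ^ 3

/-- `∂_Y χ`. -/
def flatChiY (q X Y : ℝ) : ℂ := -4 * Complex.I * cTime q Y * X ^ 2 / cInt q X Y ^ 3

section Curves

variable {q : ℝ} {x y : ℝ → ℝ} {x' y' s : ℝ}

theorem hasDerivAt_cTime (hy : HasDerivAt y y' s) :
    HasDerivAt (fun s => cTime q (y s)) (Complex.I * y') s :=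
  ((hy.ofReal_comp).const_mul Complex.I).const_add _

theorem hasDerivAt_cInt (hx : HasDerivAt x x' s) (hy : HasDerivAt y y' s) :
    HasDerivAt (fun s => cInt q (x s) (y s))
      (2 * x s * x' + 2 * cTime q (y s) * (Complex.I * y')) s := by
  refine ((hx.ofReal_comp.pow 2).add ((hasDerivAt_cTime hy).pow 2)).congr_deriv ?_
  simp

theorem hasDerivAt_flatChi (hq : q ≠ 0) (hx : HasDerivAt x x' s) (hy : HasDerivAt y y' s) :
    HasDerivAt (fun s => flatChi q (x s) (y s))
      (flatChiX q (x s) (y s) * x' + flatChiY q (x s) (y s) * y') s := by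
  have hn := cInt_ne_zero hq (x s) (y s)
  refine ((hx.ofReal_comp.pow 2).div ((hasDerivAt_cInt hx hy).pow 2)
    (pow_ne_zero 2 hn)).congr_deriv ?_
  simp only [flatChiX, flatChiY, Pi.pow_apply]
  field_simp
  unfold cInt
  push_cast
  ring

/-- The relation df = i(a + ∗dχ) is what makes the mixed components (t or ρ with θ or φ) of d𝓐 agree
with 𝓕: the a terms cancel and only derivatives of χ survive. -/
theorem hasDerivAt_flatF (hq : q ≠ 0) (hx : HasDerivAt x x' s) (hy : HasDerivAt y y' s) :
    HasDerivAt (fun s => flatF q (x s) (y s))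
      (Complex.I * (flatAX q (x s) (y s) + flatChiY q (x s) (y s)) * x'
        + Complex.I * (flatAY q (x s) (y s) + flatChiX q (x s) (y s)) * y') s := by
  have hn := cInt_ne_zero hq (x s) (y s)
  have hm := cTime_ne_zero hq (y s)
  have hc := hasDerivAt_cTime (q := q) hy
  refine ((hx.ofReal_comp.mul ((hc.pow 2).sub (hx.ofReal_comp.pow 2))).neg.div
    ((((hasDerivAt_cInt hx hy).pow 2).const_mul 2).mul hc)
    (mul_ne_zero (mul_ne_zero two_ne_zero (pow_ne_zero 2 hn)) hm)).congr_deriv ?_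
  simp only [flatChiX, flatChiY, flatAX, flatAY, Pi.pow_apply, Pi.sub_apply, Pi.mul_apply,
    Pi.neg_apply]
  field_simp
  unfold cInt
  push_cast
  ring_nf
  simp only [Complex.I_sq]
  ring

/-- Needed with `hasDerivAt_flatAY` for the curl ∂_Y a_X - ∂_X a_Y: the terms in `cTime`⁻² cancel
there, leaving 2/`cInt`² = 2χ/X². -/
theorem hasDerivAt_flatAX (hq : q ≠ 0) (hx : HasDerivAt x x' s) (hy : HasDerivAt y y' s) :
    HasDerivAt (fun s => flatAX q (x s) (y s))
      (-Complex.I * x s / (cInt q (x s) (y s) ^ 2 * cTime q (y s)) * x'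
        + (1 / cInt q (x s) (y s) ^ 2 + 1 / (2 * cInt q (x s) (y s) * cTime q (y s) ^ 2)) * y')
      s := by
  have hn := cInt_ne_zero hq (x s) (y s)
  have hm := cTime_ne_zero hq (y s)
  have hc := hasDerivAt_cTime (q := q) hy
  refine ((hasDerivAt_const s Complex.I).div
    (((hasDerivAt_cInt hx hy).const_mul 2).mul hc)
    (mul_ne_zero (mul_ne_zero two_ne_zero hn) hm)).congr_deriv ?_
  simp only [Pi.mul_apply]
  field_simp
  ring_nf
  simp only [Complex.I_sq]
  ring

theorem hasDerivAt_flatAY (hq : q ≠ 0) (hx : HasDerivAt x x' s) (hy : HasDerivAt y y' s) :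
    HasDerivAt (fun s => flatAY q (x s) (y s))
      ((1 / (2 * cInt q (x s) (y s) * cTime q (y s) ^ 2) - 1 / cInt q (x s) (y s) ^ 2) * x'
        + Complex.I * x s * (1 / (cInt q (x s) (y s) ^ 2 * cTime q (y s))
          + 1 / (cInt q (x s) (y s) * cTime q (y s) ^ 3)) * y')
      s := by
  have hn := cInt_ne_zero hq (x s) (y s)
  have hm := cTime_ne_zero hq (y s)
  have hc := hasDerivAt_cTime (q := q) hy
  refine (hx.ofReal_comp.neg.div
    (((hasDerivAt_cInt hx hy).const_mul 2).mul (hc.pow 2))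
    (mul_ne_zero (mul_ne_zero two_ne_zero hn) (pow_ne_zero 2 hm))).congr_deriv ?_
  simp only [Pi.mul_apply, Pi.pow_apply, Pi.neg_apply]
  field_simp
  unfold cInt
  push_cast
  ring

end Curves

/-! ### Field and potential in the flat coordinates. -/

theorem complex_sin_upsilon {α b : ℝ} (hα : α ≠ 0) (hb : b ≠ 0) :
    Complex.sin (upsilon α b) = 2 * ((b * α : ℝ) : ℂ) / (1 + ((b * α : ℝ) : ℂ) ^ 2) := by
  rw [← Complex.ofReal_sin, (upsilon_spec α b (mul_ne_zero hα hb)).2.2.1]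
  push_cast
  ring_nf

theorem complex_cos_upsilon {α b : ℝ} (hα : α ≠ 0) (hb : b ≠ 0) :
    Complex.cos (upsilon α b)
      = (1 - ((b * α : ℝ) : ℂ) ^ 2) / (1 + ((b * α : ℝ) : ℂ) ^ 2) := by
  rw [← Complex.ofReal_cos, (upsilon_spec α b (mul_ne_zero hα hb)).2.2.2]
  push_cast
  ring_nf

theorem one_add_sq_ne_zero (q : ℝ) : (1 + (q : ℂ) ^ 2) ≠ 0 := by
  have : (1 + q ^ 2 : ℝ) ≠ 0 := by positivity
  exact_mod_cast this

theorem sumCosh_cast_ne_zero (α t ρ : ℝ) : (sumCosh α t ρ : ℂ) ≠ 0 :=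
  Complex.ofReal_ne_zero.mpr (sumCosh_pos α t ρ).ne'

theorem cosh_sub_I_mul (x υ : ℝ) : Complex.cosh (x - Complex.I * υ)
    = Complex.cos υ * (cosh x : ℝ) - Complex.I * (Complex.sin υ * (sinh x : ℝ)) := by
  rw [Complex.cosh_sub, mul_comm Complex.I, Complex.cosh_mul_I, Complex.sinh_mul_I]
  push_cast
  ring

theorem sinh_sub_I_mul (x υ : ℝ) : Complex.sinh (x - Complex.I * υ)
    = Complex.cos υ * (sinh x : ℝ) - Complex.I * (Complex.sin υ * (cosh x : ℝ)) := by
  rw [Complex.sinh_sub, mul_comm Complex.I, Complex.cosh_mul_I, Complex.sinh_mul_I]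
  push_cast
  ring

theorem cosh_sq_cast (x : ℝ) : ((cosh x : ℝ) : ℂ) ^ 2 = ((sinh x : ℝ) : ℂ) ^ 2 + 1 := by
  exact_mod_cast cosh_sq x

/-- Expanding cosh(αt - iυ) gives (1 + q²)N = (cosh αρ - cosh αt) + q² I + 2iq sinh αt, and the
first difference equals I(X² - Y²) because cosh² - sinh² = 1. -/
theorem nFun_eq {α b : ℝ} (hα : α ≠ 0) (hb : b ≠ 0) (t ρ : ℝ) :
    nFun α b t ρ = sumCosh α t ρ / (1 + ((b * α : ℝ) : ℂ) ^ 2)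
      * cInt (b * α) (flatR α t ρ) (flatT α t ρ) := by
  have hK := one_add_sq_ne_zero (b * α)
  have hI := sumCosh_cast_ne_zero α t ρ
  have h1 := cosh_sq_cast (α * ρ)
  have h2 := cosh_sq_cast (α * t)
  rw [nFun, show (α : ℂ) * t = ((α * t : ℝ) : ℂ) by push_cast; rfl,
    show (α : ℂ) * ρ = ((α * ρ : ℝ) : ℂ) by push_cast; rfl, cosh_sub_I_mul,
    complex_sin_upsilon hα hb, complex_cos_upsilon hα hb, ← Complex.ofReal_cosh]
  generalize b * α = q at *
  simp only [cInt, cTime, flatR, flatT, Complex.ofReal_div]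
  field_simp
  simp only [sumCosh, Complex.ofReal_add]
  linear_combination (-(sinh (α * t) : ℂ) ^ 2) * Complex.I_sq + h1 - h2

theorem mFun_eq {α b : ℝ} (hα : α ≠ 0) (hb : b ≠ 0) (t ρ : ℝ) :
    mFun α b t ρ = 2 * sumCosh α t ρ / (1 + ((b * α : ℝ) : ℂ) ^ 2)
      * cTime (b * α) (flatT α t ρ) := by
  have hK := one_add_sq_ne_zero (b * α)
  have hI := sumCosh_cast_ne_zero α t ρ
  have hs : Complex.sin (upsilon α b)
      = 2 * Complex.sin ((upsilon α b / 2 : ℝ) : ℂ) * Complex.cos ((upsilon α b / 2 : ℝ) : ℂ) := by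
    rw [← Complex.sin_two_mul]; congr 1; push_cast; ring
  have hc : Complex.cos (upsilon α b) = 2 * Complex.cos ((upsilon α b / 2 : ℝ) : ℂ) ^ 2 - 1 := by
    rw [← Complex.cos_two_mul]; congr 1; push_cast; ring
  have key : mFun α b t ρ = Complex.sin (upsilon α b) * sumCosh α t ρ
      + Complex.I * ((1 + Complex.cos (upsilon α b)) * (sinh (α * t) : ℝ)) := by
    rw [mFun, show (α : ℂ) * t = ((α * t : ℝ) : ℂ) by push_cast; rfl,
      show (α : ℂ) * ρ = ((α * ρ : ℝ) : ℂ) by push_cast; rfl,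
      show Complex.I * (upsilon α b : ℂ) / 2 = Complex.I * ((upsilon α b / 2 : ℝ) : ℂ) by
        push_cast; ring,
      show (upsilon α b : ℂ) / 2 = ((upsilon α b / 2 : ℝ) : ℂ) by push_cast; rfl,
      sinh_sub_I_mul, ← Complex.ofReal_cosh, hs, hc, sumCosh]
    push_cast
    linear_combination (-2 * Complex.cos ((upsilon α b : ℂ) / 2)
      * Complex.sin ((upsilon α b : ℂ) / 2) * Complex.cosh (α * t)) * Complex.I_sq
  rw [key, complex_sin_upsilon hα hb, complex_cos_upsilon hα hb]
  simp only [cTime, flatT, Complex.ofReal_div]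
  field_simp
  ring

theorem chi_eq {α b : ℝ} (hα : α ≠ 0) (hb : b ≠ 0) (t ρ : ℝ) :
    chi α b t ρ = (α : ℂ) ^ 2 * flatChi (b * α) (flatR α t ρ) (flatT α t ρ) := by
  have hK := one_add_sq_ne_zero (b * α)
  have hI := sumCosh_cast_ne_zero α t ρ
  have hn := cInt_ne_zero (mul_ne_zero hb hα) (flatR α t ρ) (flatT α t ρ)
  rw [chi, nFun_eq hα hb, flatChi,
    show (α : ℂ) * ρ = ((α * ρ : ℝ) : ℂ) by push_cast; rfl, ← Complex.ofReal_sinh,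
    show (b : ℂ) ^ 2 * α ^ 2 = ((b * α : ℝ) : ℂ) ^ 2 by push_cast; ring]
  have hX : (sinh (α * ρ) : ℂ) = sumCosh α t ρ * (flatR α t ρ : ℂ) := by
    rw [flatR]; push_cast; field_simp
  rw [hX]
  field_simp

theorem chiR_eq {α b : ℝ} (hα : α ≠ 0) (hb : b ≠ 0) (t ρ : ℝ) :
    chiR α b t ρ = (α : ℂ) ^ 3
      * (flatChiX (b * α) (flatR α t ρ) (flatT α t ρ) * jac (flatR α t ρ) (flatT α t ρ)
        - flatChiY (b * α) (flatR α t ρ) (flatT α t ρ) * (flatR α t ρ * flatT α t ρ)) := by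
  have h := (hasDerivAt_flatChi (mul_ne_zero hb hα) (hasDerivAt_flatR_rho α t ρ)
    (hasDerivAt_flatT_rho α t ρ)).const_mul ((α : ℂ) ^ 2)
  unfold chiR
  simp only [chi_eq hα hb]
  rw [h.deriv]
  push_cast
  ring

theorem chiT_eq {α b : ℝ} (hα : α ≠ 0) (hb : b ≠ 0) (t ρ : ℝ) :
    chiT α b t ρ = (α : ℂ) ^ 3
      * (flatChiY (b * α) (flatR α t ρ) (flatT α t ρ) * jac (flatR α t ρ) (flatT α t ρ)
        - flatChiX (b * α) (flatR α t ρ) (flatT α t ρ) * (flatR α t ρ * flatT α t ρ)) := by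
  have h := (hasDerivAt_flatChi (mul_ne_zero hb hα) (hasDerivAt_flatR_t α t ρ)
    (hasDerivAt_flatT_t α t ρ)).const_mul ((α : ℂ) ^ 2)
  unfold chiT
  simp only [chi_eq hα hb]
  rw [h.deriv]
  push_cast
  ring

/-- The coefficient of `e^{iφ} sin θ dt` in the potential. -/
def potT (α q X Y : ℝ) : ℂ := (α : ℂ) ^ 3 * (flatAY q X Y * jac X Y - flatAX q X Y * (X * Y))

/-- The coefficient of `e^{iφ} sin θ dρ` in the potential. -/
def potR (α q X Y : ℝ) : ℂ := (α : ℂ) ^ 3 * (flatAX q X Y * jac X Y - flatAY q X Y * (X * Y))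

theorem coshU_eq (α t ρ : ℝ) :
    coshU α t ρ = sumCosh α t ρ * jac (flatR α t ρ) (flatT α t ρ) := by
  have h := (sumCosh_pos α t ρ).ne'
  rw [jac_flat, coshU]
  field_simp

theorem sinhU_eq (α t ρ : ℝ) :
    sinhU α t ρ = sumCosh α t ρ * (flatR α t ρ * flatT α t ρ) := by
  have h := (sumCosh_pos α t ρ).ne'
  rw [flatR, flatT, sinhU]
  field_simp

theorem deriv_coshU_rho (α t ρ : ℝ) : deriv (fun s => coshU α t s) ρ
    = α * (sumCosh α t ρ * (flatR α t ρ * flatT α t ρ ^ 2)) := by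
  have h := (sumCosh_pos α t ρ).ne'
  have h1 := (((hasDerivAt_cosh_mul α ρ).mul_const (cosh (α * t))).const_add 1).div
    (hasDerivAt_sumCosh_rho α t ρ) h
  have h2 := h1.deriv
  unfold coshU
  refine h2.trans ?_
  rw [flatR, flatT]
  field_simp
  rw [← sub_eq_zero]
  unfold sumCosh
  linear_combination (α * sinh (α * ρ)) * cosh_sq (α * t)

theorem coshU_comm (α t ρ : ℝ) : coshU α t ρ = coshU α ρ t := by
  simp only [coshU, sumCosh, add_comm, mul_comm]

theorem flatR_comm (α t ρ : ℝ) : flatR α t ρ = flatT α ρ t := by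
  simp only [flatR, flatT, sumCosh, add_comm]

theorem deriv_coshU_t (α t ρ : ℝ) : deriv (fun s => coshU α s ρ) t
    = α * (sumCosh α t ρ * (flatT α t ρ * flatR α t ρ ^ 2)) := by
  have h : (fun s => coshU α s ρ) = fun s => coshU α ρ s := funext fun s => coshU_comm α s ρ
  rw [h, deriv_coshU_rho, flatR_comm α t ρ, ← flatR_comm α ρ t]
  simp only [sumCosh, add_comm]

/-- With cosh u = IJ and sinh u = IXY the bracket is 2IX(J - Y² + iqY)/(1 + q²). Here iqY - Y² =
iYm, which is how the dt coefficient of a_X dX + a_Y dY appears. -/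
theorem factor1_mul_bracketT {α b : ℝ} (hα : α ≠ 0) (hb : b ≠ 0) (x : Fin 4 → ℝ) :
    factor1 α b x * bracketT α b (x 0) (x 1)
      = Complex.exp (Complex.I * x 3) * Complex.sin (x 2)
        * potT α (b * α) (flatR α (x 0) (x 1)) (flatT α (x 0) (x 1)) := by
  have hK := one_add_sq_ne_zero (b * α)
  have hI := sumCosh_cast_ne_zero α (x 0) (x 1)
  have hI' := (sumCosh_pos α (x 0) (x 1)).ne'
  have hn := cInt_ne_zero (mul_ne_zero hb hα) (flatR α (x 0) (x 1)) (flatT α (x 0) (x 1))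
  have hm := cTime_ne_zero (mul_ne_zero hb hα) (flatT α (x 0) (x 1))
  have hr : sinh (α * x 1) * coshU α (x 0) (x 1) / sumCosh α (x 0) (x 1)
      - α⁻¹ * deriv (fun s => coshU α (x 0) s) (x 1)
      = sumCosh α (x 0) (x 1) * flatR α (x 0) (x 1)
        * (jac (flatR α (x 0) (x 1)) (flatT α (x 0) (x 1)) - flatT α (x 0) (x 1) ^ 2) := by
    rw [deriv_coshU_rho, coshU_eq, flatR]
    field_simp
  rw [factor1, bracketT, hr, D1, nFun_eq hα hb, mFun_eq hα hb, complex_sin_upsilon hα hb,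
    complex_cos_upsilon hα hb, sinhU_eq, potT, flatAX, flatAY,
    show (α : ℂ) ^ 2 * b ^ 2 = ((b * α : ℝ) : ℂ) ^ 2 by push_cast; ring]
  generalize b * α = q at *
  push_cast
  field_simp
  unfold cTime
  ring_nf
  simp only [Complex.I_sq]
  ring

theorem factor1_mul_bracketR {α b : ℝ} (hα : α ≠ 0) (hb : b ≠ 0) (x : Fin 4 → ℝ) :
    factor1 α b x * bracketR α b (x 0) (x 1)
      = Complex.exp (Complex.I * x 3) * Complex.sin (x 2)
        * potR α (b * α) (flatR α (x 0) (x 1)) (flatT α (x 0) (x 1)) := by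
  have hK := one_add_sq_ne_zero (b * α)
  have hI := sumCosh_cast_ne_zero α (x 0) (x 1)
  have hI' := (sumCosh_pos α (x 0) (x 1)).ne'
  have hn := cInt_ne_zero (mul_ne_zero hb hα) (flatR α (x 0) (x 1)) (flatT α (x 0) (x 1))
  have hm := cTime_ne_zero (mul_ne_zero hb hα) (flatT α (x 0) (x 1))
  have hr : sinh (α * x 0) * coshU α (x 0) (x 1) / sumCosh α (x 0) (x 1)
      - α⁻¹ * deriv (fun s => coshU α s (x 1)) (x 0)
      = sumCosh α (x 0) (x 1) * flatT α (x 0) (x 1)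
        * (jac (flatR α (x 0) (x 1)) (flatT α (x 0) (x 1)) - flatR α (x 0) (x 1) ^ 2) := by
    rw [deriv_coshU_t, coshU_eq, flatT]
    field_simp
  rw [factor1, bracketR, hr, D1, nFun_eq hα hb, mFun_eq hα hb, complex_sin_upsilon hα hb,
    complex_cos_upsilon hα hb, coshU_eq, potR, flatAX, flatAY,
    show (α : ℂ) ^ 2 * b ^ 2 = ((b * α : ℝ) : ℂ) ^ 2 by push_cast; ring]
  generalize b * α = q at *
  push_cast
  field_simp
  unfold cTime
  ring_nf
  simp only [Complex.I_sq]
  ring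

theorem factor2_mul_bracketX {α b : ℝ} (hα : α ≠ 0) (hb : b ≠ 0) (x : Fin 4 → ℝ) :
    factor2 α b x * bracketX α b (x 0) (x 1)
      = Complex.exp (Complex.I * x 3)
        * (α ^ 2 * flatF (b * α) (flatR α (x 0) (x 1)) (flatT α (x 0) (x 1))) := by
  have hK := one_add_sq_ne_zero (b * α)
  have hI := sumCosh_cast_ne_zero α (x 0) (x 1)
  have hn := cInt_ne_zero (mul_ne_zero hb hα) (flatR α (x 0) (x 1)) (flatT α (x 0) (x 1))
  have hm := cTime_ne_zero (mul_ne_zero hb hα) (flatT α (x 0) (x 1))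
  have h1 := cosh_sq_cast (α * x 1)
  have h2 := cosh_sq_cast (α * x 0)
  have hX : (sinh (α * x 1) : ℂ) = sumCosh α (x 0) (x 1) * (flatR α (x 0) (x 1) : ℂ) := by
    rw [flatR]; push_cast; field_simp
  have hb' : bracketX α b (x 0) (x 1) * (1 + ((b * α : ℝ) : ℂ) ^ 2)
      = sumCosh α (x 0) (x 1) ^ 2 * (cTime (b * α) (flatT α (x 0) (x 1)) ^ 2
        - flatR α (x 0) (x 1) ^ 2) := by
    rw [bracketX, show (α : ℂ) * x 0 = ((α * x 0 : ℝ) : ℂ) by push_cast; rfl,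
      show (α : ℂ) * x 1 = ((α * x 1 : ℝ) : ℂ) by push_cast; rfl, cosh_sub_I_mul,
      complex_sin_upsilon hα hb, complex_cos_upsilon hα hb, ← Complex.ofReal_sinh]
    generalize b * α = q at *
    simp only [cTime, flatR, flatT, coshU, Complex.ofReal_div]
    field_simp
    simp only [sumCosh, Complex.ofReal_add, Complex.ofReal_mul, Complex.ofReal_one]
    linear_combination -(q : ℂ) ^ 2 * h1 - h2 - (sinh (α * x 0) : ℂ) ^ 2 * Complex.I_sq
  rw [factor2, D2, nFun_eq hα hb, mFun_eq hα hb, flatF,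
    show (α : ℂ) ^ 2 * b ^ 2 = ((b * α : ℝ) : ℂ) ^ 2 by push_cast; ring,
    show (α : ℂ) * x 1 = ((α * x 1 : ℝ) : ℂ) by push_cast; rfl, ← Complex.ofReal_sinh, hX,
    eq_div_of_mul_eq hK hb']
  generalize b * α = q at *
  field_simp

theorem factor2_mul_bracketY {α b : ℝ} (hα : α ≠ 0) (hb : b ≠ 0) (x : Fin 4 → ℝ) :
    factor2 α b x * bracketY α b (x 0) (x 1)
      = -(Complex.exp (Complex.I * x 3)
        * (α ^ 2 * flatChi (b * α) (flatR α (x 0) (x 1)) (flatT α (x 0) (x 1)))) := by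
  have hK := one_add_sq_ne_zero (b * α)
  have hI := sumCosh_cast_ne_zero α (x 0) (x 1)
  have hn := cInt_ne_zero (mul_ne_zero hb hα) (flatR α (x 0) (x 1)) (flatT α (x 0) (x 1))
  have hm := cTime_ne_zero (mul_ne_zero hb hα) (flatT α (x 0) (x 1))
  have hX : (sinh (α * x 1) : ℂ) = sumCosh α (x 0) (x 1) * (flatR α (x 0) (x 1) : ℂ) := by
    rw [flatR]; push_cast; field_simp
  have hb' : bracketY α b (x 0) (x 1) * (1 + ((b * α : ℝ) : ℂ) ^ 2)
      = sumCosh α (x 0) (x 1) ^ 2 * (2 * flatR α (x 0) (x 1)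
        * cTime (b * α) (flatT α (x 0) (x 1))) := by
    rw [bracketY, show (α : ℂ) * x 0 = ((α * x 0 : ℝ) : ℂ) by push_cast; rfl,
      show (α : ℂ) * x 1 = ((α * x 1 : ℝ) : ℂ) by push_cast; rfl, sinh_sub_I_mul,
      complex_sin_upsilon hα hb, complex_cos_upsilon hα hb, ← Complex.ofReal_sinh,
      ← Complex.ofReal_cosh, ← Complex.ofReal_sinh]
    generalize b * α = q at *
    simp only [cTime, flatR, flatT, Complex.ofReal_div]
    field_simp
    simp only [sumCosh, Complex.ofReal_add]
    linear_combination (-2 * (q : ℂ) * sinh (α * x 1) * cosh (α * x 0)) * Complex.I_sq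
  rw [factor2, D2, nFun_eq hα hb, mFun_eq hα hb, flatChi,
    show (α : ℂ) ^ 2 * b ^ 2 = ((b * α : ℝ) : ℂ) ^ 2 by push_cast; ring,
    show (α : ℂ) * x 1 = ((α * x 1 : ℝ) : ℂ) by push_cast; rfl, ← Complex.ofReal_sinh, hX,
    eq_div_of_mul_eq hK hb']
  generalize b * α = q at *
  field_simp

/-! ### The exterior derivative of the potential. -/

theorem hasDerivAt_jac {x y : ℝ → ℝ} {x' y' s : ℝ} (hx : HasDerivAt x x' s)
    (hy : HasDerivAt y y' s) :
    HasDerivAt (fun s => jac (x s) (y s)) (-(x s * x' + y s * y')) s := by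
  refine ((((hx.pow 2).const_sub 1).sub (hy.pow 2)).div_const 2).congr_deriv ?_
  simp
  ring

theorem deriv_potR_sub_deriv_potT {α q : ℝ} (hα : 0 < α) (hq : q ≠ 0) (t : ℝ) {ρ : ℝ}
    (hρ : 0 < ρ) :
    deriv (fun s => potR α q (flatR α s ρ) (flatT α s ρ)) t
      - deriv (fun s => potT α q (flatR α t s) (flatT α t s)) ρ
      = 2 * (α ^ 2 * flatChi q (flatR α t ρ) (flatT α t ρ))
        * (α ^ 2 / (sinh (α * ρ) : ℂ) ^ 2) := by
  have hx := hasDerivAt_flatR_t α t ρ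
  have hy := hasDerivAt_flatT_t α t ρ
  have kx := hasDerivAt_flatR_rho α t ρ
  have ky := hasDerivAt_flatT_rho α t ρ
  have h1 := (((hasDerivAt_flatAX hq hx hy).mul (hasDerivAt_jac hx hy).ofReal_comp).sub
    ((hasDerivAt_flatAY hq hx hy).mul (hx.ofReal_comp.mul hy.ofReal_comp))).const_mul
      ((α : ℂ) ^ 3)
  have h2 := (((hasDerivAt_flatAY hq kx ky).mul (hasDerivAt_jac kx ky).ofReal_comp).sub
    ((hasDerivAt_flatAX hq kx ky).mul (kx.ofReal_comp.mul ky.ofReal_comp))).const_mul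
      ((α : ℂ) ^ 3)
  have e1 : deriv (fun s => potR α q (flatR α s ρ) (flatT α s ρ)) t = _ := h1.deriv
  have e2 : deriv (fun s => potT α q (flatR α t s) (flatT α t s)) ρ = _ := h2.deriv
  rw [e1, e2]
  have hW := jac_sq_sub α t ρ
  have hI := sumCosh_cast_ne_zero α t ρ
  have hr : (sinh (α * ρ) : ℂ) ≠ 0 :=
    Complex.ofReal_ne_zero.mpr (sinh_pos_iff.mpr (mul_pos hα hρ)).ne'
  have hX : (flatR α t ρ : ℂ) = sinh (α * ρ) / sumCosh α t ρ := by
    rw [flatR]; push_cast; rfl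
  have hn := cInt_ne_zero hq (flatR α t ρ) (flatT α t ρ)
  have hW' : (jac (flatR α t ρ) (flatT α t ρ) : ℂ) ^ 2
      - ((flatR α t ρ : ℂ) * flatT α t ρ) ^ 2 = 1 / (sumCosh α t ρ : ℂ) ^ 2 := by
    exact_mod_cast hW
  -- Since X = sinh(αρ)/I, the target is the flat curl 2/`cInt`² times the Jacobian factor 1/I²,
  -- which is then replaced by J² - X²Y².
  have hχ : 2 * (α ^ 2 * flatChi q (flatR α t ρ) (flatT α t ρ))
        * (α ^ 2 / (sinh (α * ρ) : ℂ) ^ 2)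
      = 2 * α ^ 4 / cInt q (flatR α t ρ) (flatT α t ρ) ^ 2
        * (1 / (sumCosh α t ρ : ℂ) ^ 2) := by
    rw [flatChi]
    field_simp
    rw [hX]
    field_simp
  rw [hχ, ← hW']
  simp only [Pi.mul_apply]
  push_cast
  ring

theorem exp_I_mul_hasDerivAt (φ : ℝ) :
    HasDerivAt (fun s : ℝ => Complex.exp (Complex.I * s))
      (Complex.I * Complex.exp (Complex.I * φ)) φ := by
  have h : HasDerivAt (fun s : ℝ => Complex.I * (s : ℂ)) Complex.I φ := by
    simpa using (hasDerivAt_id φ).ofReal_comp.const_mul Complex.I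
  simpa [mul_comm] using h.cexp

theorem complex_sin_hasDerivAt (θ : ℝ) :
    HasDerivAt (fun s : ℝ => Complex.sin s) (Complex.cos θ) θ :=
  (Complex.hasDerivAt_sin θ).comp_ofReal

theorem complex_cos_hasDerivAt (θ : ℝ) :
    HasDerivAt (fun s : ℝ => Complex.cos s) (-Complex.sin θ) θ :=
  (Complex.hasDerivAt_cos θ).comp_ofReal

theorem hopfionA_eq {α b : ℝ} (hα : α ≠ 0) (hb : b ≠ 0) : hopfionA α b = fun x =>
    ![Complex.exp (Complex.I * x 3) * Complex.sin (x 2)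
        * potT α (b * α) (flatR α (x 0) (x 1)) (flatT α (x 0) (x 1)),
      Complex.exp (Complex.I * x 3) * Complex.sin (x 2)
        * potR α (b * α) (flatR α (x 0) (x 1)) (flatT α (x 0) (x 1)),
      Complex.exp (Complex.I * x 3) * α ^ 2
        * (-(Complex.I * Complex.cos (x 2)
          * flatF (b * α) (flatR α (x 0) (x 1)) (flatT α (x 0) (x 1)))
          - flatChi (b * α) (flatR α (x 0) (x 1)) (flatT α (x 0) (x 1))),
      Complex.exp (Complex.I * x 3) * α ^ 2 * Complex.sin (x 2)
        * (flatF (b * α) (flatR α (x 0) (x 1)) (flatT α (x 0) (x 1))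
          - Complex.I * Complex.cos (x 2)
            * flatChi (b * α) (flatR α (x 0) (x 1)) (flatT α (x 0) (x 1)))] := by
  funext x
  have hX := factor2_mul_bracketX hα hb x
  have hY := factor2_mul_bracketY hα hb x
  simp only [hopfionA, factor1_mul_bracketT hα hb, factor1_mul_bracketR hα hb]
  have h2 : factor2 α b x * (bracketX α b (x 0) (x 1) * (-Complex.I * Complex.cos (x 2))
        + bracketY α b (x 0) (x 1))
      = Complex.exp (Complex.I * x 3) * α ^ 2
        * (-(Complex.I * Complex.cos (x 2)
          * flatF (b * α) (flatR α (x 0) (x 1)) (flatT α (x 0) (x 1)))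
          - flatChi (b * α) (flatR α (x 0) (x 1)) (flatT α (x 0) (x 1))) := by
    linear_combination (-Complex.I * Complex.cos (x 2)) * hX + hY
  have h3 : factor2 α b x * (bracketX α b (x 0) (x 1) * Complex.sin (x 2)
        + bracketY α b (x 0) (x 1) * (Complex.I * Complex.sin (x 2) * Complex.cos (x 2)))
      = Complex.exp (Complex.I * x 3) * α ^ 2 * Complex.sin (x 2)
        * (flatF (b * α) (flatR α (x 0) (x 1)) (flatT α (x 0) (x 1))
          - Complex.I * Complex.cos (x 2)
            * flatChi (b * α) (flatR α (x 0) (x 1)) (flatT α (x 0) (x 1))) := by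
    linear_combination Complex.sin (x 2) * hX
      + (Complex.I * Complex.sin (x 2) * Complex.cos (x 2)) * hY
  rw [h2, h3]

/-- The components of `𝓕_H` above the diagonal, with the phase removed. -/
def coreF (α b : ℝ) (x : Fin 4 → ℝ) : Fin 4 → Fin 4 → ℂ :=
  let χ := chi α b (x 0) (x 1)
  let χt := chiT α b (x 0) (x 1)
  let χr := chiR α b (x 0) (x 1)
  let S : ℂ := Complex.sin (x 2)
  let C : ℂ := Complex.cos (x 2)
  let U : ℂ := χt - χr * C
  let V : ℂ := χr - χt * C
  ![![0, 2 * χ * S * (α ^ 2 / Complex.sinh (α * x 1) ^ 2), -U, V * (Complex.I * S)],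
    ![-(2 * χ * S * (α ^ 2 / Complex.sinh (α * x 1) ^ 2)), 0, -V, U * (Complex.I * S)],
    ![U, V, 0, 2 * χ * S * (Complex.I * S)],
    ![-(V * (Complex.I * S)), -(U * (Complex.I * S)), -(2 * χ * S * (Complex.I * S)), 0]]

theorem hopfionF_eq (α b : ℝ) (x : Fin 4 → ℝ) (μ ν : Fin 4) :
    hopfionF α b x μ ν = Complex.exp (Complex.I * x 3) * coreF α b x μ ν := by
  fin_cases μ <;> fin_cases ν <;>
    simp [hopfionF, coreF, wedge, Matrix.single]

theorem extD_antisymm (A : (Fin 4 → ℝ) → Fin 4 → ℂ) (x : Fin 4 → ℝ) (μ ν : Fin 4) :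
    extD A x μ ν = -extD A x ν μ := by
  simp [extD]

theorem hopfionF_antisymm (α b : ℝ) (x : Fin 4 → ℝ) (μ ν : Fin 4) :
    hopfionF α b x μ ν = -hopfionF α b x ν μ := by
  rw [hopfionF_eq, hopfionF_eq, ← mul_neg]
  congr 1
  fin_cases μ <;> fin_cases ν <;> simp [coreF]

theorem extD_self (A : (Fin 4 → ℝ) → Fin 4 → ℂ) (x : Fin 4 → ℝ) (μ : Fin 4) :
    extD A x μ μ = 0 := by
  simp [extD]

theorem hopfionF_self (α b : ℝ) (x : Fin 4 → ℝ) (μ : Fin 4) : hopfionF α b x μ μ = 0 := by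
  rw [hopfionF_eq]
  fin_cases μ <;> simp [coreF]

theorem hopfionA_apply_0 {α b : ℝ} (hα : α ≠ 0) (hb : b ≠ 0) :
    (fun y => hopfionA α b y 0) = fun y : Fin 4 → ℝ =>
      Complex.exp (Complex.I * y 3) * Complex.sin (y 2)
        * potT α (b * α) (flatR α (y 0) (y 1)) (flatT α (y 0) (y 1)) := by
  rw [hopfionA_eq hα hb]
  rfl

theorem hopfionA_apply_1 {α b : ℝ} (hα : α ≠ 0) (hb : b ≠ 0) :
    (fun y => hopfionA α b y 1) = fun y : Fin 4 → ℝ =>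
      Complex.exp (Complex.I * y 3) * Complex.sin (y 2)
        * potR α (b * α) (flatR α (y 0) (y 1)) (flatT α (y 0) (y 1)) := by
  rw [hopfionA_eq hα hb]
  rfl

theorem hopfionA_apply_2 {α b : ℝ} (hα : α ≠ 0) (hb : b ≠ 0) :
    (fun y => hopfionA α b y 2) = fun y : Fin 4 → ℝ =>
      Complex.exp (Complex.I * y 3) * α ^ 2
        * (-(Complex.I * Complex.cos (y 2) * flatF (b * α) (flatR α (y 0) (y 1)) (flatT α (y 0) (y 1)))
          - flatChi (b * α) (flatR α (y 0) (y 1)) (flatT α (y 0) (y 1))) := by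
  rw [hopfionA_eq hα hb]
  rfl

theorem hopfionA_apply_3 {α b : ℝ} (hα : α ≠ 0) (hb : b ≠ 0) :
    (fun y => hopfionA α b y 3) = fun y : Fin 4 → ℝ =>
      Complex.exp (Complex.I * y 3) * α ^ 2 * Complex.sin (y 2)
        * (flatF (b * α) (flatR α (y 0) (y 1)) (flatT α (y 0) (y 1))
          - Complex.I * Complex.cos (y 2) * flatChi (b * α) (flatR α (y 0) (y 1)) (flatT α (y 0) (y 1))) := by
  rw [hopfionA_eq hα hb]
  rfl

theorem extD_01 {α b : ℝ} (hα : 0 < α) (hb : b ≠ 0) (x : Fin 4 → ℝ) (hx : 0 < x 1) :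
    extD (hopfionA α b) x 0 1 = hopfionF α b x 0 1 := by
  have h := deriv_potR_sub_deriv_potT hα (mul_ne_zero hb hα.ne') (x 0) hx
  have e1 : partialDeriv 0 (fun y => hopfionA α b y 1) x
      = Complex.exp (Complex.I * x 3) * Complex.sin (x 2)
        * deriv (fun s => potR α (b * α) (flatR α s (x 1)) (flatT α s (x 1))) (x 0) := by
    rw [hopfionA_apply_1 hα.ne' hb]
    exact deriv_const_mul_field (v := fun s => potR α (b * α) (flatR α s (x 1)) (flatT α s (x 1)))
      (Complex.exp (Complex.I * x 3) * Complex.sin (x 2))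
  have e2 : partialDeriv 1 (fun y => hopfionA α b y 0) x
      = Complex.exp (Complex.I * x 3) * Complex.sin (x 2)
        * deriv (fun s => potT α (b * α) (flatR α (x 0) s) (flatT α (x 0) s)) (x 1) := by
    rw [hopfionA_apply_0 hα.ne' hb]
    exact deriv_const_mul_field (v := fun s => potT α (b * α) (flatR α (x 0) s) (flatT α (x 0) s))
      (Complex.exp (Complex.I * x 3) * Complex.sin (x 2))
  rw [extD, e1, e2, ← mul_sub, h, hopfionF_eq]
  simp [coreF, chi_eq hα.ne' hb]
  ring

theorem extD_02 {α b : ℝ} (hα : α ≠ 0) (hb : b ≠ 0) (x : Fin 4 → ℝ) :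
    extD (hopfionA α b) x 0 2 = hopfionF α b x 0 2 := by
  have hq := mul_ne_zero hb hα
  have hf0 := hasDerivAt_flatF hq (hasDerivAt_flatR_t α (x 0) (x 1))
    (hasDerivAt_flatT_t α (x 0) (x 1))
  have hc0 := hasDerivAt_flatChi hq (hasDerivAt_flatR_t α (x 0) (x 1))
    (hasDerivAt_flatT_t α (x 0) (x 1))
  have e1 := (congrArg (fun f => partialDeriv 0 f x) (hopfionA_apply_2 hα hb)).trans <|
    (((hf0.const_mul (Complex.I * Complex.cos (x 2))).neg.sub hc0).const_mul
      (Complex.exp (Complex.I * x 3) * α ^ 2)).deriv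
  have e2 := (congrArg (fun f => partialDeriv 2 f x) (hopfionA_apply_0 hα hb)).trans <|
    (((complex_sin_hasDerivAt (x 2)).const_mul (Complex.exp (Complex.I * x 3))).mul_const
      (potT α (b * α) (flatR α (x 0) (x 1)) (flatT α (x 0) (x 1)))).deriv
  rw [extD, e1, e2, hopfionF_eq]
  simp [coreF, chi_eq hα hb, chiT_eq hα hb, chiR_eq hα hb, potT]
  ring_nf
  simp only [Complex.I_sq]
  ring

theorem extD_03 {α b : ℝ} (hα : α ≠ 0) (hb : b ≠ 0) (x : Fin 4 → ℝ) :
    extD (hopfionA α b) x 0 3 = hopfionF α b x 0 3 := by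
  have hq := mul_ne_zero hb hα
  have hf0 := hasDerivAt_flatF hq (hasDerivAt_flatR_t α (x 0) (x 1))
    (hasDerivAt_flatT_t α (x 0) (x 1))
  have hc0 := hasDerivAt_flatChi hq (hasDerivAt_flatR_t α (x 0) (x 1))
    (hasDerivAt_flatT_t α (x 0) (x 1))
  have e1 := (congrArg (fun f => partialDeriv 0 f x) (hopfionA_apply_3 hα hb)).trans <|
    ((hf0.sub (hc0.const_mul (Complex.I * Complex.cos (x 2)))).const_mul
      (Complex.exp (Complex.I * x 3) * α ^ 2 * Complex.sin (x 2))).deriv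
  have e2 := (congrArg (fun f => partialDeriv 3 f x) (hopfionA_apply_0 hα hb)).trans <|
    (((exp_I_mul_hasDerivAt (x 3)).mul_const (Complex.sin (x 2))).mul_const
      (potT α (b * α) (flatR α (x 0) (x 1)) (flatT α (x 0) (x 1)))).deriv
  rw [extD, e1, e2, hopfionF_eq]
  simp [coreF, chi_eq hα hb, chiT_eq hα hb, chiR_eq hα hb, potT]
  ring

theorem extD_12 {α b : ℝ} (hα : α ≠ 0) (hb : b ≠ 0) (x : Fin 4 → ℝ) :
    extD (hopfionA α b) x 1 2 = hopfionF α b x 1 2 := by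
  have hq := mul_ne_zero hb hα
  have hf1 := hasDerivAt_flatF hq (hasDerivAt_flatR_rho α (x 0) (x 1))
    (hasDerivAt_flatT_rho α (x 0) (x 1))
  have hc1 := hasDerivAt_flatChi hq (hasDerivAt_flatR_rho α (x 0) (x 1))
    (hasDerivAt_flatT_rho α (x 0) (x 1))
  have e1 := (congrArg (fun f => partialDeriv 1 f x) (hopfionA_apply_2 hα hb)).trans <|
    (((hf1.const_mul (Complex.I * Complex.cos (x 2))).neg.sub hc1).const_mul
      (Complex.exp (Complex.I * x 3) * α ^ 2)).deriv
  have e2 := (congrArg (fun f => partialDeriv 2 f x) (hopfionA_apply_1 hα hb)).trans <|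
    (((complex_sin_hasDerivAt (x 2)).const_mul (Complex.exp (Complex.I * x 3))).mul_const
      (potR α (b * α) (flatR α (x 0) (x 1)) (flatT α (x 0) (x 1)))).deriv
  rw [extD, e1, e2, hopfionF_eq]
  simp [coreF, chi_eq hα hb, chiT_eq hα hb, chiR_eq hα hb, potR]
  ring_nf
  simp only [Complex.I_sq]
  ring

theorem extD_13 {α b : ℝ} (hα : α ≠ 0) (hb : b ≠ 0) (x : Fin 4 → ℝ) :
    extD (hopfionA α b) x 1 3 = hopfionF α b x 1 3 := by
  have hq := mul_ne_zero hb hα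
  have hf1 := hasDerivAt_flatF hq (hasDerivAt_flatR_rho α (x 0) (x 1))
    (hasDerivAt_flatT_rho α (x 0) (x 1))
  have hc1 := hasDerivAt_flatChi hq (hasDerivAt_flatR_rho α (x 0) (x 1))
    (hasDerivAt_flatT_rho α (x 0) (x 1))
  have e1 := (congrArg (fun f => partialDeriv 1 f x) (hopfionA_apply_3 hα hb)).trans <|
    ((hf1.sub (hc1.const_mul (Complex.I * Complex.cos (x 2)))).const_mul
      (Complex.exp (Complex.I * x 3) * α ^ 2 * Complex.sin (x 2))).deriv
  have e2 := (congrArg (fun f => partialDeriv 3 f x) (hopfionA_apply_1 hα hb)).trans <|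
    (((exp_I_mul_hasDerivAt (x 3)).mul_const (Complex.sin (x 2))).mul_const
      (potR α (b * α) (flatR α (x 0) (x 1)) (flatT α (x 0) (x 1)))).deriv
  rw [extD, e1, e2, hopfionF_eq]
  simp [coreF, chi_eq hα hb, chiT_eq hα hb, chiR_eq hα hb, potR]
  ring

/-- The f terms cancel, and iχ(1 - cos² θ + sin² θ) = 2iχ sin² θ remains. -/
theorem extD_23 {α b : ℝ} (hα : α ≠ 0) (hb : b ≠ 0) (x : Fin 4 → ℝ) :
    extD (hopfionA α b) x 2 3 = hopfionF α b x 2 3 := by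
  have e1 := (congrArg (fun f => partialDeriv 2 f x) (hopfionA_apply_3 hα hb)).trans <|
    (((complex_sin_hasDerivAt (x 2)).const_mul
      (Complex.exp (Complex.I * x 3) * α ^ 2)).mul ((((complex_cos_hasDerivAt (x 2)).const_mul
      Complex.I).mul_const
        (flatChi (b * α) (flatR α (x 0) (x 1)) (flatT α (x 0) (x 1)))).const_sub
        (flatF (b * α) (flatR α (x 0) (x 1)) (flatT α (x 0) (x 1))))).deriv
  have e2 := (congrArg (fun f => partialDeriv 3 f x) (hopfionA_apply_2 hα hb)).trans <|
    (((exp_I_mul_hasDerivAt (x 3)).mul_const ((α : ℂ) ^ 2)).mul_const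
      (-(Complex.I * Complex.cos (x 2)
        * (flatF (b * α) (flatR α (x 0) (x 1)) (flatT α (x 0) (x 1))))
        - (flatChi (b * α) (flatR α (x 0) (x 1)) (flatT α (x 0) (x 1))))).deriv
  rw [extD, e1, e2, hopfionF_eq]
  simp [coreF, chi_eq hα hb]
  ring_nf
  simp only [Complex.I_sq, Complex.cos_sq']
  ring

theorem extD_hopfionA {α b : ℝ} (hα : 0 < α) (hb : b ≠ 0) (x : Fin 4 → ℝ) (hx : 0 < x 1) :
    extD (hopfionA α b) x = hopfionF α b x := by
  have h01 := extD_01 hα hb x hx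
  have h02 := extD_02 hα.ne' hb x
  have h03 := extD_03 hα.ne' hb x
  have h12 := extD_12 hα.ne' hb x
  have h13 := extD_13 hα.ne' hb x
  have h23 := extD_23 hα.ne' hb x
  have key : ∀ μ ν : Fin 4, μ < ν → extD (hopfionA α b) x μ ν = hopfionF α b x μ ν := by
    intro μ ν h
    have : (μ = 0 ∧ ν = 1) ∨ (μ = 0 ∧ ν = 2) ∨ (μ = 0 ∧ ν = 3) ∨ (μ = 1 ∧ ν = 2)
        ∨ (μ = 1 ∧ ν = 3) ∨ (μ = 2 ∧ ν = 3) := by omega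
    rcases this with ⟨rfl, rfl⟩ | ⟨rfl, rfl⟩ | ⟨rfl, rfl⟩ | ⟨rfl, rfl⟩ | ⟨rfl, rfl⟩ | ⟨rfl, rfl⟩
    · exact h01
    · exact h02
    · exact h03
    · exact h12
    · exact h13
    · exact h23
  ext μ ν
  rcases lt_trichotomy μ ν with h | rfl | h
  · exact key μ ν h
  · rw [extD_self, hopfionF_self]
  · rw [extD_antisymm, hopfionF_antisymm, key ν μ h]

theorem contDiff_hopfionA {α b : ℝ} (hα : α ≠ 0) (hb : b ≠ 0) :
    ContDiff ℝ ∞ (hopfionA α b) := by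
  have hq := mul_ne_zero hb hα
  have c0 : ∀ i : Fin 4, ContDiff ℝ ∞ (fun x : Fin 4 → ℝ => x i) := fun i => contDiff_apply _ _ i
  have cI : ContDiff ℝ ∞ (fun x : Fin 4 → ℝ => sumCosh α (x 0) (x 1)) := by
    unfold sumCosh
    fun_prop
  have cR : ContDiff ℝ ∞ (fun x : Fin 4 → ℝ => flatR α (x 0) (x 1)) := by
    unfold flatR
    exact ContDiff.div (by fun_prop) cI fun x => (sumCosh_pos _ _ _).ne'
  have cT : ContDiff ℝ ∞ (fun x : Fin 4 → ℝ => flatT α (x 0) (x 1)) := by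
    unfold flatT
    exact ContDiff.div (by fun_prop) cI fun x => (sumCosh_pos _ _ _).ne'
  have cRc : ContDiff ℝ ∞ (fun x : Fin 4 → ℝ => (flatR α (x 0) (x 1) : ℂ)) :=
    Complex.ofRealCLM.contDiff.comp cR
  have cTc : ContDiff ℝ ∞ (fun x : Fin 4 → ℝ => (flatT α (x 0) (x 1) : ℂ)) :=
    Complex.ofRealCLM.contDiff.comp cT
  have cC : ∀ i : Fin 4, ContDiff ℝ ∞ (fun x : Fin 4 → ℝ => (x i : ℂ)) := fun i =>
    Complex.ofRealCLM.contDiff.comp (c0 i)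
  have cJ : ContDiff ℝ ∞ (fun x : Fin 4 → ℝ =>
      (jac (flatR α (x 0) (x 1)) (flatT α (x 0) (x 1)) : ℂ)) := by
    have : ContDiff ℝ ∞ (fun x : Fin 4 → ℝ => jac (flatR α (x 0) (x 1)) (flatT α (x 0) (x 1))) := by
      unfold jac
      fun_prop
    exact Complex.ofRealCLM.contDiff.comp this
  have cm : ContDiff ℝ ∞ (fun x : Fin 4 → ℝ => cTime (b * α) (flatT α (x 0) (x 1))) := by
    unfold cTime
    fun_prop
  have cn : ContDiff ℝ ∞ (fun x : Fin 4 → ℝ =>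
      cInt (b * α) (flatR α (x 0) (x 1)) (flatT α (x 0) (x 1))) := by
    unfold cInt
    fun_prop
  have hm := fun x : Fin 4 → ℝ => cTime_ne_zero hq (flatT α (x 0) (x 1))
  have hn := fun x : Fin 4 → ℝ => cInt_ne_zero hq (flatR α (x 0) (x 1)) (flatT α (x 0) (x 1))
  have cχ : ContDiff ℝ ∞ (fun x : Fin 4 → ℝ =>
      flatChi (b * α) (flatR α (x 0) (x 1)) (flatT α (x 0) (x 1))) := by
    simp only [flatChi, div_eq_mul_inv]
    exact ContDiff.mul (by fun_prop) (ContDiff.inv (by fun_prop) fun x => by simp [hn x])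
  have cF : ContDiff ℝ ∞ (fun x : Fin 4 → ℝ =>
      flatF (b * α) (flatR α (x 0) (x 1)) (flatT α (x 0) (x 1))) := by
    simp only [flatF, div_eq_mul_inv]
    exact ContDiff.mul (by fun_prop) (ContDiff.inv (by fun_prop) fun x => by simp [hm x, hn x])
  have cAX : ContDiff ℝ ∞ (fun x : Fin 4 → ℝ =>
      flatAX (b * α) (flatR α (x 0) (x 1)) (flatT α (x 0) (x 1))) := by
    simp only [flatAX, div_eq_mul_inv]
    exact ContDiff.mul (by fun_prop) (ContDiff.inv (by fun_prop) fun x => by simp [hm x, hn x])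
  have cAY : ContDiff ℝ ∞ (fun x : Fin 4 → ℝ =>
      flatAY (b * α) (flatR α (x 0) (x 1)) (flatT α (x 0) (x 1))) := by
    simp only [flatAY, div_eq_mul_inv]
    exact ContDiff.mul (by fun_prop) (ContDiff.inv (by fun_prop) fun x => by simp [hm x, hn x])
  have ce : ContDiff ℝ ∞ (fun x : Fin 4 → ℝ => Complex.exp (Complex.I * x 3)) :=
    (contDiff_const.mul (cC 3)).cexp
  have cS : ContDiff ℝ ∞ (fun x : Fin 4 → ℝ => Complex.sin (x 2)) :=
    Complex.contDiff_sin.restrict_scalars ℝ |>.comp (cC 2)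
  have cCos : ContDiff ℝ ∞ (fun x : Fin 4 → ℝ => Complex.cos (x 2)) :=
    Complex.contDiff_cos.restrict_scalars ℝ |>.comp (cC 2)
  rw [hopfionA_eq hα hb, contDiff_pi]
  intro i
  fin_cases i
  · simp only [potT]
    exact (ce.mul cS).mul (contDiff_const.mul ((cAY.mul cJ).sub (cAX.mul (cRc.mul cTc))))
  · simp only [potR]
    exact (ce.mul cS).mul (contDiff_const.mul ((cAX.mul cJ).sub (cAY.mul (cRc.mul cTc))))
  · exact (ce.mul contDiff_const).mul (((contDiff_const.mul cCos).mul cF).neg.sub cχ)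
  · exact ((ce.mul contDiff_const).mul cS).mul (cF.sub ((contDiff_const.mul cCos).mul cχ))

/-! ### The helicity current in the flat coordinates. -/

/-- The diagonal of the inverse metric. -/
def invMetric (α ρ θ : ℝ) : Fin 4 → ℝ :=
  ![-cosh (α * ρ) ^ 2, cosh (α * ρ) ^ 2, α ^ 2 / tanh (α * ρ) ^ 2,
    α ^ 2 / (tanh (α * ρ) ^ 2 * sin θ ^ 2)]

theorem tanh_pos_of_pos {x : ℝ} (hx : 0 < x) : 0 < tanh x := by
  rw [tanh_eq_sinh_div_cosh]
  exact div_pos (sinh_pos_iff.mpr hx) (cosh_pos x)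

theorem metric_inv {α : ℝ} {x : Fin 4 → ℝ} (hα : 0 < α) (hρ : 0 < x 1) (hθ : sin (x 2) ≠ 0) :
    (metric α x)⁻¹ = Matrix.diagonal (invMetric α (x 1) (x 2)) := by
  have h1 := (cosh_pos (α * x 1)).ne'
  have h2 := (tanh_pos_of_pos (mul_pos hα hρ)).ne'
  apply Matrix.inv_eq_right_inv
  rw [metric, Matrix.diagonal_mul_diagonal, ← Matrix.diagonal_one]
  congr 1
  funext i
  fin_cases i <;> simp [invMetric] <;> field_simp

theorem raise_eq {α : ℝ} {x : Fin 4 → ℝ} (hα : 0 < α) (hρ : 0 < x 1) (hθ : sin (x 2) ≠ 0)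
    (W : Matrix (Fin 4) (Fin 4) ℂ) (μ ν : Fin 4) :
    raise α x W μ ν
      = ((invMetric α (x 1) (x 2) μ * invMetric α (x 1) (x 2) ν : ℝ) : ℂ) * W μ ν := by
  simp only [raise, metric_inv hα hρ hθ]
  rw [Finset.sum_eq_single μ, Finset.sum_eq_single ν]
  · simp
  · intro l _ hl
    simp [Matrix.diagonal_apply_ne _ hl.symm]
  · simp
  · intro k _ hk
    simp [Matrix.diagonal_apply_ne _ hk.symm]
  · simp

theorem det_metric (α : ℝ) (x : Fin 4 → ℝ) : (metric α x).det
    = -(tanh (α * x 1) ^ 2 / (α ^ 2 * cosh (α * x 1) ^ 2) * sin (x 2)) ^ 2 := by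
  rw [metric, Matrix.det_diagonal, Fin.prod_univ_four]
  simp only [Matrix.cons_val]
  ring

theorem volumeFactor_eq (α : ℝ) {x : Fin 4 → ℝ} (hθ : 0 ≤ sin (x 2)) : volumeFactor α x
    = tanh (α * x 1) ^ 2 / (α ^ 2 * cosh (α * x 1) ^ 2) * sin (x 2) := by
  rw [volumeFactor, det_metric, abs_neg, abs_sq, sqrt_sq]
  positivity

theorem im_re_sub_re_im (z w : ℂ) :
    z.im * w.re - z.re * w.im = (z * (starRingEnd ℂ) w).im := by
  simp [Complex.mul_im]
  ring

/-- Field and potential carry the same unimodular phase, so the current does not depend on φ. -/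
theorem phase_mul_conj (φ : ℝ) (d : ℝ) (z w : ℂ) :
    (((d : ℂ) * (Complex.exp (Complex.I * φ) * z))
      * (starRingEnd ℂ) (Complex.exp (Complex.I * φ) * w)).im
      = d * (z * (starRingEnd ℂ) w).im := by
  have h : Complex.exp (Complex.I * φ) * (starRingEnd ℂ) (Complex.exp (Complex.I * φ)) = 1 := by
    rw [Complex.mul_conj, Complex.normSq_eq_norm_sq, mul_comm, Complex.norm_exp_ofReal_mul_I]
    simp
  rw [← Complex.im_ofReal_mul]
  congr 1
  rw [map_mul]
  linear_combination ((d : ℂ) * z * (starRingEnd ℂ) w) * h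

/-- `∂_ρ χ` in terms of the flat coordinates. -/
def gradR (α q X Y : ℝ) : ℂ := (α : ℂ) ^ 3 * (flatChiX q X Y * jac X Y - flatChiY q X Y * (X * Y))

/-- `∂_t χ` in terms of the flat coordinates. -/
def gradT (α q X Y : ℝ) : ℂ := (α : ℂ) ^ 3 * (flatChiY q X Y * jac X Y - flatChiX q X Y * (X * Y))

/-- The contribution of `𝓕_{tρ}` to the helicity density. -/
def densR (α q X Y : ℝ) : ℝ := (α ^ 2 * flatChi q X Y * (starRingEnd ℂ) (potR α q X Y)).im

/-- The contribution of `𝓕_{tρ}` to the radial helicity current. -/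
def densT (α q X Y : ℝ) : ℝ := (α ^ 2 * flatChi q X Y * (starRingEnd ℂ) (potT α q X Y)).im

/-- The even angular part of the helicity density. -/
def angT (α q X Y : ℝ) : ℝ :=
  (gradT α q X Y * (starRingEnd ℂ) (α ^ 2 * flatChi q X Y)
    + Complex.I * gradR α q X Y * (starRingEnd ℂ) (α ^ 2 * flatF q X Y)).im

/-- The even angular part of the radial helicity current. -/
def angR (α q X Y : ℝ) : ℝ :=
  (gradR α q X Y * (starRingEnd ℂ) (α ^ 2 * flatChi q X Y)
    + Complex.I * gradT α q X Y * (starRingEnd ℂ) (α ^ 2 * flatF q X Y)).im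

/-- On the axis the metric is degenerate and its inverse a default value, but the volume factor
vanishes. The formulas below therefore hold on the closed interval [0, π]. -/
theorem hopfionCurrent_of_sin_eq_zero (α b t ρ : ℝ) {θ : ℝ} (φ : ℝ) (hθ : sin θ = 0) (μ : Fin 4) :
    hopfionCurrent α b t ρ θ φ μ = 0 := by
  rw [hopfionCurrent, helicityCurrent, volumeFactor_eq]
  · simp [hθ]
  · simp [hθ]

/-- The components of `𝓐_H`, with the phase removed. -/
def coreA (α q X Y θ : ℝ) : Fin 4 → ℂ :=
  ![Complex.sin θ * potT α q X Y, Complex.sin θ * potR α q X Y,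
    -(Complex.I * Complex.cos θ * (α ^ 2 * flatF q X Y)) - α ^ 2 * flatChi q X Y,
    Complex.sin θ * (α ^ 2 * flatF q X Y - Complex.I * Complex.cos θ * (α ^ 2 * flatChi q X Y))]

theorem hopfionA_eq_core {α b : ℝ} (hα : α ≠ 0) (hb : b ≠ 0) (x : Fin 4 → ℝ) (μ : Fin 4) :
    hopfionA α b x μ = Complex.exp (Complex.I * x 3)
      * coreA α (b * α) (flatR α (x 0) (x 1)) (flatT α (x 0) (x 1)) (x 2) μ := by
  rw [hopfionA_eq hα hb]
  fin_cases μ <;> simp [coreA] <;> ring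

theorem hopfionCurrent_eq_sum {α b : ℝ} (hα : 0 < α) (hb : b ≠ 0) (t : ℝ) {ρ θ : ℝ} (φ : ℝ)
    (hρ : 0 < ρ) (hθ : 0 < sin θ) (μ : Fin 4) : hopfionCurrent α b t ρ θ φ μ
      = 1 / (8 * π) * ∑ ν, tanh (α * ρ) ^ 2 / (α ^ 2 * cosh (α * ρ) ^ 2) * sin θ
        * (invMetric α ρ θ μ * invMetric α ρ θ ν) * (coreF α b ![t, ρ, θ, φ] μ ν
          * (starRingEnd ℂ) (coreA α (b * α) (flatR α t ρ) (flatT α t ρ) θ ν)).im := by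
  have hθ' : 0 ≤ sin ((![t, ρ, θ, φ] : Fin 4 → ℝ) 2) := hθ.le
  rw [hopfionCurrent, helicityCurrent, volumeFactor_eq α hθ', mul_assoc, Finset.mul_sum]
  congr 1
  refine Finset.sum_congr rfl fun ν _ => ?_
  rw [im_re_sub_re_im, raise_eq hα (x := ![t, ρ, θ, φ]) hρ hθ.ne', hopfionF_eq,
    hopfionA_eq_core hα.ne' hb, phase_mul_conj, mul_assoc _ (_ * _)]
  rfl

theorem conj_sin_ofReal (θ : ℝ) : (starRingEnd ℂ) (Complex.sin θ) = Complex.sin θ := by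
  rw [← Complex.ofReal_sin, Complex.conj_ofReal]

theorem conj_cos_ofReal (θ : ℝ) : (starRingEnd ℂ) (Complex.cos θ) = Complex.cos θ := by
  rw [← Complex.ofReal_cos, Complex.conj_ofReal]

theorem chiR_eq_gradR {α b : ℝ} (hα : α ≠ 0) (hb : b ≠ 0) (t ρ : ℝ) :
    chiR α b t ρ = gradR α (b * α) (flatR α t ρ) (flatT α t ρ) := chiR_eq hα hb t ρ

theorem chiT_eq_gradT {α b : ℝ} (hα : α ≠ 0) (hb : b ≠ 0) (t ρ : ℝ) :
    chiT α b t ρ = gradT α (b * α) (flatR α t ρ) (flatT α t ρ) := chiT_eq hα hb t ρ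

theorem hopfionCurrent_zero {α b : ℝ} (hα : 0 < α) (hb : b ≠ 0) (t : ℝ) {ρ θ : ℝ} (φ : ℝ)
    (hρ : 0 < ρ) (hθ : 0 ≤ sin θ) : hopfionCurrent α b t ρ θ φ 0
      = 1 / (8 * π) * -(2 * sin θ ^ 3 * densR α (b * α) (flatR α t ρ) (flatT α t ρ)
        + sin θ * (1 + cos θ ^ 2) * angT α (b * α) (flatR α t ρ) (flatT α t ρ)
        - 2 * sin θ * cos θ * angR α (b * α) (flatR α t ρ) (flatT α t ρ)) := by
  rcases hθ.eq_or_lt with h | h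
  · rw [hopfionCurrent_of_sin_eq_zero α b t ρ φ h.symm, ← h]
    simp
  have hr : sinh (α * ρ) ≠ 0 := (sinh_pos_iff.mpr (mul_pos hα hρ)).ne'
  have hc := (cosh_pos (α * ρ)).ne'
  have hS : Complex.sin θ ≠ 0 := by
    rw [← Complex.ofReal_sin]
    exact Complex.ofReal_ne_zero.mpr h.ne'
  have hr' : Complex.sinh (α * ρ) ≠ 0 := by
    rw [← Complex.ofReal_mul, ← Complex.ofReal_sinh]
    exact Complex.ofReal_ne_zero.mpr hr
  have hα' : (α : ℂ) ≠ 0 := Complex.ofReal_ne_zero.mpr hα.ne'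
  -- The factor sinh²(αρ)/α² cancels α²/sinh²(αρ) in 𝓕_{tρ}; in `v2` and `v3` the conformal factor
  -- drops out altogether.
  have v1 : tanh (α * ρ) ^ 2 / (α ^ 2 * cosh (α * ρ) ^ 2) * sin θ
      * (invMetric α ρ θ 0 * invMetric α ρ θ 1) = -(sinh (α * ρ) ^ 2 / α ^ 2 * sin θ) := by
    simp only [invMetric, Matrix.cons_val, tanh_eq_sinh_div_cosh]
    field_simp
  have v2 : tanh (α * ρ) ^ 2 / (α ^ 2 * cosh (α * ρ) ^ 2) * sin θ
      * (invMetric α ρ θ 0 * invMetric α ρ θ 2) = -sin θ := by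
    simp only [invMetric, Matrix.cons_val, tanh_eq_sinh_div_cosh]
    field_simp
  have v3 : tanh (α * ρ) ^ 2 / (α ^ 2 * cosh (α * ρ) ^ 2) * sin θ
      * (invMetric α ρ θ 0 * invMetric α ρ θ 3) = -(1 / sin θ) := by
    simp only [invMetric, Matrix.cons_val, tanh_eq_sinh_div_cosh]
    field_simp
  rw [hopfionCurrent_eq_sum hα hb t φ hρ h, Fin.sum_univ_four, v1, v2, v3]
  simp only [coreF, coreA, Matrix.cons_val, chiR_eq_gradR hα.ne' hb, chiT_eq_gradT hα.ne' hb,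
    chi_eq hα.ne' hb, zero_mul, Complex.zero_im, mul_zero, zero_add, densR, angT, angR]
  generalize gradR α (b * α) (flatR α t ρ) (flatT α t ρ) = gr
  generalize gradT α (b * α) (flatR α t ρ) (flatT α t ρ) = gt
  generalize (α : ℂ) ^ 2 * flatChi (b * α) (flatR α t ρ) (flatT α t ρ) = χ
  generalize (α : ℂ) ^ 2 * flatF (b * α) (flatR α t ρ) (flatT α t ρ) = f
  generalize potR α (b * α) (flatR α t ρ) (flatT α t ρ) = c
  simp only [← Complex.im_ofReal_mul, ← Complex.add_im, ← Complex.sub_im,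
    ← Complex.neg_im]
  congr 2
  simp only [map_mul, map_sub, map_neg, Complex.conj_I, conj_sin_ofReal, conj_cos_ofReal]
  push_cast
  field_simp
  ring_nf
  simp only [Complex.I_sq]
  ring

theorem hopfionCurrent_one {α b : ℝ} (hα : 0 < α) (hb : b ≠ 0) (t : ℝ) {ρ θ : ℝ} (φ : ℝ)
    (hρ : 0 < ρ) (hθ : 0 ≤ sin θ) : hopfionCurrent α b t ρ θ φ 1
      = 1 / (8 * π) * (2 * sin θ ^ 3 * densT α (b * α) (flatR α t ρ) (flatT α t ρ)
        + sin θ * (1 + cos θ ^ 2) * angR α (b * α) (flatR α t ρ) (flatT α t ρ)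
        - 2 * sin θ * cos θ * angT α (b * α) (flatR α t ρ) (flatT α t ρ)) := by
  rcases hθ.eq_or_lt with h | h
  · rw [hopfionCurrent_of_sin_eq_zero α b t ρ φ h.symm, ← h]
    simp
  have hr : sinh (α * ρ) ≠ 0 := (sinh_pos_iff.mpr (mul_pos hα hρ)).ne'
  have hc := (cosh_pos (α * ρ)).ne'
  have hS : Complex.sin θ ≠ 0 := by
    rw [← Complex.ofReal_sin]
    exact Complex.ofReal_ne_zero.mpr h.ne'
  have hr' : Complex.sinh (α * ρ) ≠ 0 := by
    rw [← Complex.ofReal_mul, ← Complex.ofReal_sinh]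
    exact Complex.ofReal_ne_zero.mpr hr
  have hα' : (α : ℂ) ≠ 0 := Complex.ofReal_ne_zero.mpr hα.ne'
  have v1 : tanh (α * ρ) ^ 2 / (α ^ 2 * cosh (α * ρ) ^ 2) * sin θ
      * (invMetric α ρ θ 1 * invMetric α ρ θ 0) = -(sinh (α * ρ) ^ 2 / α ^ 2 * sin θ) := by
    simp only [invMetric, Matrix.cons_val, tanh_eq_sinh_div_cosh]
    field_simp
  have v2 : tanh (α * ρ) ^ 2 / (α ^ 2 * cosh (α * ρ) ^ 2) * sin θ
      * (invMetric α ρ θ 1 * invMetric α ρ θ 2) = sin θ := by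
    simp only [invMetric, Matrix.cons_val, tanh_eq_sinh_div_cosh]
    field_simp
  have v3 : tanh (α * ρ) ^ 2 / (α ^ 2 * cosh (α * ρ) ^ 2) * sin θ
      * (invMetric α ρ θ 1 * invMetric α ρ θ 3) = 1 / sin θ := by
    simp only [invMetric, Matrix.cons_val, tanh_eq_sinh_div_cosh]
    field_simp
  rw [hopfionCurrent_eq_sum hα hb t φ hρ h, Fin.sum_univ_four, v1, v2, v3]
  simp only [coreF, coreA, Matrix.cons_val, chiR_eq_gradR hα.ne' hb, chiT_eq_gradT hα.ne' hb,
    chi_eq hα.ne' hb, zero_mul, Complex.zero_im, mul_zero, add_zero, densT, angT, angR]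
  generalize gradR α (b * α) (flatR α t ρ) (flatT α t ρ) = gr
  generalize gradT α (b * α) (flatR α t ρ) (flatT α t ρ) = gt
  generalize (α : ℂ) ^ 2 * flatChi (b * α) (flatR α t ρ) (flatT α t ρ) = χ
  generalize (α : ℂ) ^ 2 * flatF (b * α) (flatR α t ρ) (flatT α t ρ) = f
  generalize potT α (b * α) (flatR α t ρ) (flatT α t ρ) = c
  simp only [← Complex.im_ofReal_mul, ← Complex.add_im, ← Complex.sub_im]
  congr 2
  simp only [map_mul, map_sub, map_neg, Complex.conj_I, conj_sin_ofReal, conj_cos_ofReal]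
  push_cast
  field_simp
  ring_nf
  simp only [Complex.I_sq]
  ring

/-! ### A primitive of the radial helicity density. -/

/-- The squared modulus of the complexified interval. -/
def intNormSq (q X Y : ℝ) : ℝ := (q ^ 2 + (Y + X) ^ 2) * (q ^ 2 + (Y - X) ^ 2)

theorem intNormSq_ne_zero {q : ℝ} (hq : q ≠ 0) (X Y : ℝ) : intNormSq q X Y ≠ 0 := by
  have h : 0 < q ^ 2 := by positivity
  unfold intNormSq
  positivity

theorem conj_cTime (q Y : ℝ) : (starRingEnd ℂ) (cTime q Y) = q - Complex.I * Y := by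
  simp [cTime, sub_eq_add_neg]

theorem conj_cInt (q X Y : ℝ) :
    (starRingEnd ℂ) (cInt q X Y) = X ^ 2 + (q - Complex.I * Y) ^ 2 := by
  simp [cInt, conj_cTime]

theorem cInt_mul_conj (q X Y : ℝ) :
    cInt q X Y * (starRingEnd ℂ) (cInt q X Y) = intNormSq q X Y := by
  rw [conj_cInt, cInt, cTime, intNormSq]
  push_cast
  have h4 : Complex.I ^ 4 = 1 := Complex.I_pow_four
  ring_nf
  simp only [h4, Complex.I_sq]
  ring

theorem im_flatChiX_mul_conj {q : ℝ} (hq : q ≠ 0) (X Y : ℝ) :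
    (flatChiX q X Y * (starRingEnd ℂ) (flatChi q X Y)).im
      = 8 * q * X ^ 5 * Y / intNormSq q X Y ^ 3 := by
  have hn := cInt_ne_zero hq X Y
  have hn' : (starRingEnd ℂ) (cInt q X Y) ≠ 0 := (map_ne_zero _).mpr hn
  have h : flatChiX q X Y * (starRingEnd ℂ) (flatChi q X Y)
      = (2 * X ^ 3 * (cTime q Y ^ 2 - X ^ 2) * (starRingEnd ℂ) (cInt q X Y))
        / ((intNormSq q X Y ^ 3 : ℝ) : ℂ) := by
    rw [Complex.ofReal_pow, ← cInt_mul_conj]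
    simp only [flatChiX, flatChi, map_div₀, map_pow, Complex.conj_ofReal]
    field_simp
  rw [h, Complex.div_ofReal_im]
  congr 1
  rw [conj_cInt, cTime]
  simp [pow_succ]
  ring

theorem im_flatChiY_mul_conj {q : ℝ} (hq : q ≠ 0) (X Y : ℝ) :
    (flatChiY q X Y * (starRingEnd ℂ) (flatChi q X Y)).im
      = -(4 * q * X ^ 4 * (q ^ 2 + X ^ 2 + Y ^ 2)) / intNormSq q X Y ^ 3 := by
  have hn := cInt_ne_zero hq X Y
  have hn' : (starRingEnd ℂ) (cInt q X Y) ≠ 0 := (map_ne_zero _).mpr hn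
  have h : flatChiY q X Y * (starRingEnd ℂ) (flatChi q X Y)
      = (-4 * Complex.I * cTime q Y * X ^ 4 * (starRingEnd ℂ) (cInt q X Y))
        / ((intNormSq q X Y ^ 3 : ℝ) : ℂ) := by
    rw [Complex.ofReal_pow, ← cInt_mul_conj]
    simp only [flatChiY, flatChi, map_div₀, map_pow, Complex.conj_ofReal]
    field_simp
  rw [h, Complex.div_ofReal_im]
  congr 1
  rw [conj_cInt, cTime]
  simp [pow_succ]
  ring

/-- A potential of the conserved current of the wave `χ`. -/
def waveCharge (q X Y : ℝ) : ℝ :=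
  1 / (6 * q ^ 4) * (3 / 8 * (arctan ((Y + X) / q) - arctan ((Y - X) / q))
    - 3 / 4 * q * X * (q ^ 2 + Y ^ 2 - X ^ 2) / intNormSq q X Y
    - 2 * q ^ 3 * X ^ 3 * (q ^ 2 + Y ^ 2 - X ^ 2) / intNormSq q X Y ^ 2)

/-- The helicity contained in a ball of radius `X` at the time `Y`, in the flat coordinates, up to
the factor `α ^ 4`. -/
def flatHelicity (q X Y : ℝ) : ℝ :=
  -(2 / 3) * (flatChi q X Y * (starRingEnd ℂ) (flatF q X Y)).re + waveCharge q X Y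

section Curves

variable {q : ℝ} {x y : ℝ → ℝ} {x' y' s : ℝ}

theorem hasDerivAt_intNormSq (hx : HasDerivAt x x' s) (hy : HasDerivAt y y' s) :
    HasDerivAt (fun s => intNormSq q (x s) (y s))
      (2 * (y s + x s) * (y' + x') * (q ^ 2 + (y s - x s) ^ 2)
        + (q ^ 2 + (y s + x s) ^ 2) * (2 * (y s - x s) * (y' - x'))) s := by
  refine ((((hy.add hx).pow 2).const_add (q ^ 2)).mul
    (((hy.sub hx).pow 2).const_add (q ^ 2))).congr_deriv ?_
  simp

/-- The coefficients are -4/3 times Im(χ_Y χ̄) and Im(χ_X χ̄). This form is closed because χ_YY -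
χ_XX + 2χ/X² = 0 has a real potential. -/
theorem hasDerivAt_waveCharge (hq : q ≠ 0) (hx : HasDerivAt x x' s) (hy : HasDerivAt y y' s) :
    HasDerivAt (fun s => waveCharge q (x s) (y s))
      (16 / 3 * q * x s ^ 4 * (q ^ 2 + x s ^ 2 + y s ^ 2) / intNormSq q (x s) (y s) ^ 3 * x'
        - 32 / 3 * q * x s ^ 5 * y s / intNormSq q (x s) (y s) ^ 3 * y') s := by
  have hD := intNormSq_ne_zero hq (x s) (y s)
  have hd := hasDerivAt_intNormSq (q := q) hx hy
  have hw := ((hy.pow 2).const_add (q ^ 2)).sub (hx.pow 2)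
  refine ((((((hy.add hx).div_const q).arctan.sub ((hy.sub hx).div_const q).arctan).const_mul
    (3 / 8)).sub (((hx.const_mul (3 / 4 * q)).mul hw).div hd hD)).sub
    ((((hx.pow 3).const_mul (2 * q ^ 3)).mul hw).div (hd.pow 2) (pow_ne_zero 2 hD))
    |>.const_mul (1 / (6 * q ^ 4))).congr_deriv ?_
  have h : 0 < q ^ 2 := by positivity
  have h1 : q ^ 2 + (y s + x s) ^ 2 ≠ 0 := by positivity
  have h2 : q ^ 2 + (y s - x s) ^ 2 ≠ 0 := by positivity
  have h3 : 1 + ((y s + x s) / q) ^ 2 = (q ^ 2 + (y s + x s) ^ 2) / q ^ 2 := by field_simp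
  have h4 : 1 + ((y s - x s) / q) ^ 2 = (q ^ 2 + (y s - x s) ^ 2) / q ^ 2 := by field_simp
  simp only [Pi.mul_apply, Pi.pow_apply, Pi.sub_apply, Pi.add_apply, h3, h4, intNormSq]
  field_simp
  push_cast
  ring

/-- By df = i(a + ∗dχ), the X-derivative of Re(χ f̄) is Im(χ ā_X + iχ_X f̄) - Im(χ_Y χ̄), and
similarly in Y. The sign of the last term is wrong, and `waveCharge` supplies the missing 2 Im(χ_Y
χ̄), times -2/3. -/
theorem hasDerivAt_flatHelicity (hq : q ≠ 0) (hx : HasDerivAt x x' s) (hy : HasDerivAt y y' s) :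
    HasDerivAt (fun s => flatHelicity q (x s) (y s))
      (-(2 / 3) * ((flatChi q (x s) (y s) * (starRingEnd ℂ) (flatAX q (x s) (y s))
          + flatChiY q (x s) (y s) * (starRingEnd ℂ) (flatChi q (x s) (y s))
          + Complex.I * flatChiX q (x s) (y s) * (starRingEnd ℂ) (flatF q (x s) (y s))).im * x'
        + (flatChi q (x s) (y s) * (starRingEnd ℂ) (flatAY q (x s) (y s))
          + flatChiX q (x s) (y s) * (starRingEnd ℂ) (flatChi q (x s) (y s))
          + Complex.I * flatChiY q (x s) (y s)
            * (starRingEnd ℂ) (flatF q (x s) (y s))).im * y')) s := by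
  have h1 := hasDerivAt_flatChi hq hx hy
  have h2 : HasDerivAt (fun s => (starRingEnd ℂ) (flatF q (x s) (y s))) _ s :=
    Complex.conjCLE.toContinuousLinearMap.hasFDerivAt.comp_hasDerivAt s
      (hasDerivAt_flatF hq hx hy)
  have h3 := Complex.reCLM.hasFDerivAt.comp_hasDerivAt s (h1.mul h2)
  refine ((h3.const_mul (-(2 / 3))).add (hasDerivAt_waveCharge hq hx hy)).congr_deriv ?_
  have hX := im_flatChiX_mul_conj hq (x s) (y s)
  have hY := im_flatChiY_mul_conj hq (x s) (y s)
  have e1 : 16 / 3 * q * x s ^ 4 * (q ^ 2 + x s ^ 2 + y s ^ 2) / intNormSq q (x s) (y s) ^ 3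
      = -(4 / 3) * (flatChiY q (x s) (y s) * (starRingEnd ℂ) (flatChi q (x s) (y s))).im := by
    rw [hY]; ring
  have e2 : 32 / 3 * q * x s ^ 5 * y s / intNormSq q (x s) (y s) ^ 3
      = 4 / 3 * (flatChiX q (x s) (y s) * (starRingEnd ℂ) (flatChi q (x s) (y s))).im := by
    rw [hX]; ring
  rw [e1, e2]
  simp
  ring

end Curves

theorem hasDerivAt_flatHelicity_rho {q : ℝ} (α : ℝ) (hq : q ≠ 0) (t ρ : ℝ) :
    HasDerivAt (fun s => α ^ 4 * flatHelicity q (flatR α t s) (flatT α t s))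
      (-(2 / 3) * (densR α q (flatR α t ρ) (flatT α t ρ)
        + angT α q (flatR α t ρ) (flatT α t ρ))) ρ := by
  refine ((hasDerivAt_flatHelicity hq (hasDerivAt_flatR_rho α t ρ)
    (hasDerivAt_flatT_rho α t ρ)).const_mul (α ^ 4)).congr_deriv ?_
  simp only [densR, angT, potR, gradT, gradR]
  simp [← Complex.ofReal_pow]
  ring

theorem flatHelicity_zero_left (q Y : ℝ) : flatHelicity q 0 Y = 0 := by
  simp [flatHelicity, waveCharge, flatChi]

/-- The point (1, 0) is the common limit of all slices of constant t at the horizon. -/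
theorem flatHelicity_one_zero {q : ℝ} (hq : q ≠ 0) : flatHelicity q 1 0
    = 1 / (8 * q ^ 4) * (arctan (1 / q) + q * (1 - q ^ 2) / (1 + q ^ 2) ^ 2) := by
  have hK : 1 + q ^ 2 ≠ 0 := by positivity
  have h : flatChi q 1 0 * (starRingEnd ℂ) (flatF q 1 0)
      = ((-(q ^ 2 - 1) / (2 * (1 + q ^ 2) ^ 4 * q) : ℝ) : ℂ) := by
    have hK' := one_add_sq_ne_zero q
    simp [flatChi, flatF, cInt, cTime, Complex.conj_ofNat]
    field_simp
  rw [flatHelicity, h, Complex.ofReal_re, waveCharge, intNormSq]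
  have : arctan ((0 - 1) / q) = -arctan (1 / q) := by rw [← arctan_neg]; congr 1; ring
  rw [this, zero_add, zero_sub]
  have hK2 : q ^ 2 + 1 ≠ 0 := by positivity
  simp only [neg_sq, one_pow]
  field_simp
  ring

/-! ### Decay towards the horizon. -/

theorem continuous_flatR (α t : ℝ) : Continuous (fun ρ => flatR α t ρ) :=
  continuous_iff_continuousAt.mpr fun ρ => (hasDerivAt_flatR_rho α t ρ).continuousAt

theorem continuous_flatT (α t : ℝ) : Continuous (fun ρ => flatT α t ρ) :=
  continuous_iff_continuousAt.mpr fun ρ => (hasDerivAt_flatT_rho α t ρ).continuousAt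

theorem inv_sumCosh_le (α t ρ : ℝ) : (sumCosh α t ρ)⁻¹ ≤ 2 * exp (-α * ρ) := by
  have h : exp (α * ρ) / 2 ≤ sumCosh α t ρ := by
    have h1 := cosh_pos (α * t)
    have h2 := exp_pos (-(α * ρ))
    rw [sumCosh, cosh_eq (α * ρ)]
    linarith
  refine (inv_anti₀ (by positivity) h).trans_eq ?_
  rw [inv_div, neg_mul, exp_neg]
  rfl

theorem tendsto_exp_neg_mul {α : ℝ} (hα : 0 < α) :
    Tendsto (fun ρ : ℝ => exp (-α * ρ)) atTop (𝓝 0) :=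
  tendsto_exp_atBot.comp (tendsto_id.const_mul_atTop_of_neg (neg_lt_zero.mpr hα))

theorem isBigO_inv_sumCosh (α t : ℝ) :
    (fun ρ => (sumCosh α t ρ)⁻¹) =O[atTop] fun ρ => exp (-α * ρ) := by
  refine IsBigO.of_bound 2 (Eventually.of_forall fun ρ => ?_)
  rw [norm_of_nonneg (inv_nonneg.mpr (sumCosh_pos α t ρ).le), norm_of_nonneg (exp_pos _).le]
  exact inv_sumCosh_le α t ρ

theorem tendsto_flatT {α : ℝ} (hα : 0 < α) (t : ℝ) :
    Tendsto (fun ρ => flatT α t ρ) atTop (𝓝 0) := by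
  have h := ((isBigO_inv_sumCosh α t).trans_tendsto (tendsto_exp_neg_mul hα)).const_mul
    (sinh (α * t))
  simpa [flatT, div_eq_mul_inv] using h

theorem one_sub_flatR (α t ρ : ℝ) :
    1 - flatR α t ρ = (exp (-α * ρ) + cosh (α * t)) * (sumCosh α t ρ)⁻¹ := by
  have h := (sumCosh_pos α t ρ).ne'
  rw [flatR, neg_mul, ← cosh_sub_sinh]
  field_simp
  rw [sumCosh]
  ring

theorem tendsto_flatR {α : ℝ} (hα : 0 < α) (t : ℝ) :
    Tendsto (fun ρ => flatR α t ρ) atTop (𝓝 1) := by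
  have h := (((tendsto_exp_neg_mul hα).add_const (cosh (α * t))).mul
    ((isBigO_inv_sumCosh α t).trans_tendsto (tendsto_exp_neg_mul hα))).const_sub 1
  simp only [← one_sub_flatR, sub_sub_cancel, mul_zero, sub_zero] at h
  exact h

theorem isBigO_flatT (α t : ℝ) :
    (fun ρ => flatT α t ρ) =O[atTop] fun ρ => exp (-α * ρ) := by
  simpa [flatT, div_eq_mul_inv] using (isBigO_inv_sumCosh α t).const_mul_left (sinh (α * t))

theorem isBigO_jac_flat {α : ℝ} (hα : 0 < α) (t : ℝ) :
    (fun ρ => jac (flatR α t ρ) (flatT α t ρ)) =O[atTop] fun ρ => exp (-α * ρ) := by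
  -- Write J = (1 + X)(1 - X)/2 - Y²/2: both 1 - X and Y are bounded multiples of 1/I.
  have e : (fun ρ => jac (flatR α t ρ) (flatT α t ρ)) = fun ρ =>
      ((1 + flatR α t ρ) / 2 * (exp (-α * ρ) + cosh (α * t))) * (sumCosh α t ρ)⁻¹
        + (-flatT α t ρ / 2) * flatT α t ρ := by
    funext ρ
    rw [mul_assoc, ← one_sub_flatR, jac]
    ring
  rw [e]
  have h1 := (((tendsto_flatR hα t).const_add 1).div_const 2).mul
    ((tendsto_exp_neg_mul hα).add_const (cosh (α * t)))
  have h2 := ((tendsto_flatT hα t).neg.div_const 2)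
  refine IsBigO.add ?_ ?_
  · simpa using (h1.isBigO_one ℝ).mul (isBigO_inv_sumCosh α t)
  · simpa using (h2.isBigO_one ℝ).mul (isBigO_flatT α t)

/-- Functions of the flat coordinates that are continuous combinations of the entries of the
conformal Jacobian. -/
def IsJacobianCombination (u : ℝ → ℝ → ℝ) : Prop :=
  ∃ h₁ h₂ : ℝ × ℝ → ℝ, Continuous h₁ ∧ Continuous h₂ ∧
    ∀ X Y, u X Y = h₁ (X, Y) * jac X Y + h₂ (X, Y) * (X * Y)

namespace IsJacobianCombination

theorem add {u v : ℝ → ℝ → ℝ} (hu : IsJacobianCombination u) (hv : IsJacobianCombination v) :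
    IsJacobianCombination (fun X Y => u X Y + v X Y) := by
  obtain ⟨f, g, hf, hg, hu⟩ := hu
  obtain ⟨f', g', hf', hg', hv⟩ := hv
  refine ⟨fun p => f p + f' p, fun p => g p + g' p, hf.add hf', hg.add hg', fun X Y => ?_⟩
  simp only [hu, hv]
  ring

theorem im_mul_conj {f g k : ℝ → ℝ → ℂ} (c : ℝ) (hf : Continuous fun p : ℝ × ℝ => f p.1 p.2)
    (hg : Continuous fun p : ℝ × ℝ => g p.1 p.2) (hk : Continuous fun p : ℝ × ℝ => k p.1 p.2) :
    IsJacobianCombination (fun X Y =>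
      (c * (f X Y * jac X Y - g X Y * (X * Y)) * (starRingEnd ℂ) (k X Y)).im) := by
  refine ⟨fun p => (c * f p.1 p.2 * (starRingEnd ℂ) (k p.1 p.2)).im,
    fun p => -(c * g p.1 p.2 * (starRingEnd ℂ) (k p.1 p.2)).im, ?_, ?_, fun X Y => ?_⟩
  · exact Complex.continuous_im.comp
      ((continuous_const.mul hf).mul (Complex.continuous_conj.comp hk))
  · exact (Complex.continuous_im.comp
      ((continuous_const.mul hg).mul (Complex.continuous_conj.comp hk))).neg
  · simp
    ring

/-- The coefficients converge as (X, Y) → (1, 0), hence stay bounded, while J and XY decay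
exponentially. -/
theorem isBigO {u : ℝ → ℝ → ℝ} (hu : IsJacobianCombination u) {α : ℝ} (t : ℝ)
    (hα : 0 < α) :
    (fun ρ => u (flatR α t ρ) (flatT α t ρ)) =O[atTop] fun ρ => exp (-α * ρ) := by
  obtain ⟨f, g, hf, hg, hu⟩ := hu
  simp only [hu]
  have hp := (tendsto_flatR hα t).prodMk_nhds (tendsto_flatT hα t)
  have h1 := ((hf.tendsto _).comp hp).isBigO_one ℝ
  have h2 := ((hg.tendsto _).comp hp).isBigO_one ℝ
  refine IsBigO.add ?_ ?_
  · simpa using h1.mul (isBigO_jac_flat hα t)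
  · simpa using h2.mul (((tendsto_flatR hα t).isBigO_one ℝ).mul (isBigO_flatT α t))

theorem continuous {u : ℝ → ℝ → ℝ} (hu : IsJacobianCombination u) {α : ℝ} (t : ℝ) :
    Continuous (fun ρ => u (flatR α t ρ) (flatT α t ρ)) := by
  obtain ⟨f, g, hf, hg, hu⟩ := hu
  simp only [hu, jac]
  have h1 := continuous_flatR α t
  have h2 := continuous_flatT α t
  fun_prop

theorem integrableOn {u : ℝ → ℝ → ℝ} (hu : IsJacobianCombination u) {α : ℝ} (t : ℝ)
    (hα : 0 < α) :
    IntegrableOn (fun ρ => u (flatR α t ρ) (flatT α t ρ)) (Ioi 0) :=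
  integrable_of_isBigO_exp_neg hα (hu.continuous t).continuousOn (hu.isBigO t hα)

theorem tendsto {u : ℝ → ℝ → ℝ} (hu : IsJacobianCombination u) {α : ℝ} (t : ℝ)
    (hα : 0 < α) :
    Tendsto (fun ρ => u (flatR α t ρ) (flatT α t ρ)) atTop (𝓝 0) :=
  (hu.isBigO t hα).trans_tendsto (tendsto_exp_neg_mul hα)

end IsJacobianCombination

theorem continuous_cTime (q : ℝ) : Continuous (fun p : ℝ × ℝ => cTime q p.2) := by
  unfold cTime
  fun_prop

theorem continuous_cInt (q : ℝ) : Continuous (fun p : ℝ × ℝ => cInt q p.1 p.2) := by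
  have := continuous_cTime q
  unfold cInt
  fun_prop

theorem continuous_flatChi {q : ℝ} (hq : q ≠ 0) :
    Continuous (fun p : ℝ × ℝ => flatChi q p.1 p.2) := by
  have h := continuous_cInt q
  exact Continuous.div (by fun_prop) (by fun_prop) fun p => pow_ne_zero 2 (cInt_ne_zero hq _ _)

theorem continuous_flatF {q : ℝ} (hq : q ≠ 0) :
    Continuous (fun p : ℝ × ℝ => flatF q p.1 p.2) := by
  have h := continuous_cInt q
  have h' := continuous_cTime q
  exact Continuous.div (by fun_prop) (by fun_prop) fun p => by
    simp [cInt_ne_zero hq, cTime_ne_zero hq]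

theorem continuous_flatAX {q : ℝ} (hq : q ≠ 0) :
    Continuous (fun p : ℝ × ℝ => flatAX q p.1 p.2) := by
  have h := continuous_cInt q
  have h' := continuous_cTime q
  exact Continuous.div (by fun_prop) (by fun_prop) fun p => by
    simp [cInt_ne_zero hq, cTime_ne_zero hq]

theorem continuous_flatAY {q : ℝ} (hq : q ≠ 0) :
    Continuous (fun p : ℝ × ℝ => flatAY q p.1 p.2) := by
  have h := continuous_cInt q
  have h' := continuous_cTime q
  exact Continuous.div (by fun_prop) (by fun_prop) fun p => by
    simp [cInt_ne_zero hq, cTime_ne_zero hq]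

theorem continuous_flatChiX {q : ℝ} (hq : q ≠ 0) :
    Continuous (fun p : ℝ × ℝ => flatChiX q p.1 p.2) := by
  have h := continuous_cInt q
  have h' := continuous_cTime q
  exact Continuous.div (by fun_prop) (by fun_prop) fun p => pow_ne_zero 3 (cInt_ne_zero hq _ _)

theorem continuous_flatChiY {q : ℝ} (hq : q ≠ 0) :
    Continuous (fun p : ℝ × ℝ => flatChiY q p.1 p.2) := by
  have h := continuous_cInt q
  have h' := continuous_cTime q
  exact Continuous.div (by fun_prop) (by fun_prop) fun p => pow_ne_zero 3 (cInt_ne_zero hq _ _)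

theorem isJacobianCombination_densR {q : ℝ} (hq : q ≠ 0) (α : ℝ) :
    IsJacobianCombination (densR α q) := by
  -- The minus sign comes from Im(z w̄) = -Im(w z̄): here the potential, not χ, carries the Jacobian
  -- entries.
  have h := IsJacobianCombination.im_mul_conj (-α ^ 3) (continuous_flatAX hq)
    (continuous_flatAY hq) (k := fun X Y => α ^ 2 * flatChi q X Y)
    (continuous_const.mul (continuous_flatChi hq))
  convert h using 3 with X Y
  rw [densR, potR]
  simp [← Complex.ofReal_pow]
  ring

theorem isJacobianCombination_densT {q : ℝ} (hq : q ≠ 0) (α : ℝ) :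
    IsJacobianCombination (densT α q) := by
  have h := IsJacobianCombination.im_mul_conj (-α ^ 3) (continuous_flatAY hq)
    (continuous_flatAX hq) (k := fun X Y => α ^ 2 * flatChi q X Y)
    (continuous_const.mul (continuous_flatChi hq))
  convert h using 3 with X Y
  rw [densT, potT]
  simp [← Complex.ofReal_pow]
  ring

theorem isJacobianCombination_angT {q : ℝ} (hq : q ≠ 0) (α : ℝ) :
    IsJacobianCombination (angT α q) := by
  have h1 := IsJacobianCombination.im_mul_conj (α ^ 3) (continuous_flatChiY hq)
    (continuous_flatChiX hq) (k := fun X Y => α ^ 2 * flatChi q X Y)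
    (continuous_const.mul (continuous_flatChi hq))
  -- The factor -i in `k` becomes, under conjugation, the i in front of the gradient term.
  have h2 := IsJacobianCombination.im_mul_conj (α ^ 3) (continuous_flatChiX hq)
    (continuous_flatChiY hq) (k := fun X Y => -Complex.I * (α ^ 2 * flatF q X Y))
    (continuous_const.mul (continuous_const.mul (continuous_flatF hq)))
  convert h1.add h2 using 3 with X Y
  rw [angT, gradT, gradR, ← Complex.add_im]
  congr 1
  simp only [map_mul, map_neg, Complex.conj_I]
  push_cast
  ring

theorem isJacobianCombination_angR {q : ℝ} (hq : q ≠ 0) (α : ℝ) :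
    IsJacobianCombination (angR α q) := by
  have h1 := IsJacobianCombination.im_mul_conj (α ^ 3) (continuous_flatChiX hq)
    (continuous_flatChiY hq) (k := fun X Y => α ^ 2 * flatChi q X Y)
    (continuous_const.mul (continuous_flatChi hq))
  have h2 := IsJacobianCombination.im_mul_conj (α ^ 3) (continuous_flatChiY hq)
    (continuous_flatChiX hq) (k := fun X Y => -Complex.I * (α ^ 2 * flatF q X Y))
    (continuous_const.mul (continuous_const.mul (continuous_flatF hq)))
  convert h1.add h2 using 3 with X Y
  rw [angR, gradT, gradR, ← Complex.add_im]
  congr 1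
  simp only [map_mul, map_neg, Complex.conj_I]
  push_cast
  ring

/-! ### Integration over spheres, total helicity and flux. -/

/-- Both even weights integrate to 8/3, so only the sum A + B survives; the last term is odd about θ
= π/2. -/
theorem integral_angular (A B C : ℝ) :
    ∫ θ in (0 : ℝ)..π, (2 * sin θ ^ 3 * A + sin θ * (1 + cos θ ^ 2) * B - 2 * sin θ * cos θ * C)
      = 8 / 3 * (A + B) := by
  have hd : ∀ θ : ℝ, HasDerivAt (fun θ => (2 / 3 * cos θ ^ 3 - 2 * cos θ) * A
      - (cos θ + cos θ ^ 3 / 3) * B + cos θ ^ 2 * C)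
      (2 * sin θ ^ 3 * A + sin θ * (1 + cos θ ^ 2) * B - 2 * sin θ * cos θ * C) θ := by
    intro θ
    have h := hasDerivAt_cos θ
    refine ((((((h.pow 3).const_mul (2 / 3)).sub (h.const_mul 2)).mul_const A).sub
      ((h.add ((h.pow 3).div_const 3)).mul_const B)).add ((h.pow 2).mul_const C)).congr_deriv ?_
    have h3 : sin θ ^ 3 = sin θ * (1 - cos θ ^ 2) := by rw [← sin_sq]; ring
    rw [h3]
    push_cast
    ring
  rw [intervalIntegral.integral_eq_sub_of_hasDerivAt (fun θ _ => hd θ)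
    (Continuous.intervalIntegrable (by fun_prop) _ _)]
  simp
  ring

theorem integral_sphere (c A B C : ℝ) : ∫ θ in (0 : ℝ)..π, ∫ _φ in (0 : ℝ)..(2 * π),
    1 / (8 * π) * (c * (2 * sin θ ^ 3 * A + sin θ * (1 + cos θ ^ 2) * B
      - 2 * sin θ * cos θ * C)) = c * (2 / 3 * (A + B)) := by
  simp only [intervalIntegral.integral_const, smul_eq_mul, intervalIntegral.integral_const_mul,
    integral_angular]
  field_simp
  ring

theorem integral_hopfionCurrent_zero {α b : ℝ} (hα : 0 < α) (hb : b ≠ 0) (t : ℝ) {ρ : ℝ}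
    (hρ : 0 < ρ) :
    ∫ θ in (0 : ℝ)..π, ∫ φ in (0 : ℝ)..(2 * π), hopfionCurrent α b t ρ θ φ 0
      = -(2 / 3) * (densR α (b * α) (flatR α t ρ) (flatT α t ρ)
        + angT α (b * α) (flatR α t ρ) (flatT α t ρ)) := by
  refine Eq.trans ?_ ((integral_sphere (-1) (densR α (b * α) (flatR α t ρ) (flatT α t ρ))
    (angT α (b * α) (flatR α t ρ) (flatT α t ρ))
    (angR α (b * α) (flatR α t ρ) (flatT α t ρ))).trans (by ring))
  refine intervalIntegral.integral_congr fun θ hθ => ?_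
  rw [uIcc_of_le pi_pos.le] at hθ
  simp only [hopfionCurrent_zero hα hb t _ hρ (sin_nonneg_of_nonneg_of_le_pi hθ.1 hθ.2),
    neg_one_mul]

theorem integral_hopfionCurrent_one {α b : ℝ} (hα : 0 < α) (hb : b ≠ 0) (t : ℝ) {ρ : ℝ}
    (hρ : 0 < ρ) :
    ∫ θ in (0 : ℝ)..π, ∫ φ in (0 : ℝ)..(2 * π), hopfionCurrent α b t ρ θ φ 1
      = 2 / 3 * (densT α (b * α) (flatR α t ρ) (flatT α t ρ)
        + angR α (b * α) (flatR α t ρ) (flatT α t ρ)) := by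
  refine Eq.trans ?_ ((integral_sphere 1 (densT α (b * α) (flatR α t ρ) (flatT α t ρ))
    (angR α (b * α) (flatR α t ρ) (flatT α t ρ))
    (angT α (b * α) (flatR α t ρ) (flatT α t ρ))).trans (by ring))
  refine intervalIntegral.integral_congr fun θ hθ => ?_
  rw [uIcc_of_le pi_pos.le] at hθ
  simp only [hopfionCurrent_one hα hb t _ hρ (sin_nonneg_of_nonneg_of_le_pi hθ.1 hθ.2),
    one_mul]

theorem tendsto_helicityFlux {α b : ℝ} (hα : 0 < α) (hb : b ≠ 0) (t : ℝ) :
    Tendsto (fun ρ => helicityFlux α b t ρ) atTop (𝓝 0) := by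
  have hq := mul_ne_zero hb hα.ne'
  have h := ((((isJacobianCombination_densT hq α).add
    (isJacobianCombination_angR hq α)).tendsto t hα).const_mul (2 / 3)).neg
  rw [mul_zero, neg_zero] at h
  refine h.congr' ?_
  filter_upwards [eventually_gt_atTop 0] with ρ hρ
  rw [helicityFlux, integral_hopfionCurrent_one hα hb t hρ]

theorem continuous_flatHelicity {q : ℝ} (hq : q ≠ 0) :
    Continuous (fun p : ℝ × ℝ => flatHelicity q p.1 p.2) := by
  have h1 := continuous_flatChi hq
  have h2 := Complex.continuous_conj.comp (continuous_flatF hq)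
  have h3 := Complex.continuous_re.comp (h1.mul h2)
  have h4 : Continuous (fun p : ℝ × ℝ => waveCharge q p.1 p.2) := by
    have hD : Continuous (fun p : ℝ × ℝ => intNormSq q p.1 p.2) := by
      unfold intNormSq
      fun_prop
    unfold waveCharge
    refine continuous_const.mul (((continuous_const.mul ?_).sub ?_).sub ?_)
    · exact (continuous_arctan.comp (by fun_prop)).sub (continuous_arctan.comp (by fun_prop))
    · exact Continuous.div (by fun_prop) hD fun p => intNormSq_ne_zero hq _ _
    · exact Continuous.div (by fun_prop) (hD.pow 2) fun p =>
        pow_ne_zero 2 (intNormSq_ne_zero hq _ _)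
  exact (continuous_const.mul h3).add h4

/-- The fundamental theorem of calculus along a slice: the primitive vanishes at ρ = 0, where X = 0,
and its limit at infinity does not involve t. -/
theorem totalHelicity_eq {α b : ℝ} (hα : 0 < α) (hb : b ≠ 0) (t : ℝ) :
    totalHelicity α b t = helicityValue α b := by
  have hq := mul_ne_zero hb hα.ne'
  have hlim : Tendsto (fun ρ => α ^ 4 * flatHelicity (b * α) (flatR α t ρ) (flatT α t ρ)) atTop
      (𝓝 (α ^ 4 * flatHelicity (b * α) 1 0)) :=
    (((continuous_flatHelicity hq).tendsto (1, 0)).comp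
      ((tendsto_flatR hα t).prodMk_nhds (tendsto_flatT hα t))).const_mul _
  have hint := (((isJacobianCombination_densR hq α).add
    (isJacobianCombination_angT hq α)).integrableOn t hα).const_mul (-(2 / 3))
  have h := integral_Ioi_of_hasDerivAt_of_tendsto'
    (fun ρ _ => hasDerivAt_flatHelicity_rho α hq t ρ) hint hlim
  have h0 : flatR α t 0 = 0 := by simp [flatR]
  rw [totalHelicity, setIntegral_congr_fun measurableSet_Ioi
    (fun ρ hρ => integral_hopfionCurrent_zero hα hb t hρ), h, h0, flatHelicity_zero_left,
    flatHelicity_one_zero hq, helicityValue, mul_comm α b]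
  have hα' := hα.ne'
  have hK : b ^ 2 * α ^ 2 + 1 ≠ 0 := by positivity
  have hK' : 1 + (b * α) ^ 2 ≠ 0 := by positivity
  field_simp
  ring

theorem integrableOn_hopfionCurrent_zero {α b : ℝ} (hα : 0 < α) (hb : b ≠ 0) (t : ℝ) :
    IntegrableOn (fun p : ℝ × ℝ × ℝ => hopfionCurrent α b t p.1 p.2.1 p.2.2 0)
      (Ioi 0 ×ˢ (Ioo 0 π ×ˢ Ioo 0 (2 * π))) := by
  have hq := mul_ne_zero hb hα.ne'
  -- The density is a sum of three products of an exponentially decaying function of ρ and a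
  -- continuous function of θ.
  have key : ∀ (u : ℝ → ℝ → ℝ), IsJacobianCombination u → ∀ v : ℝ → ℝ, Continuous v →
      IntegrableOn (fun p : ℝ × ℝ × ℝ => u (flatR α t p.1) (flatT α t p.1) * v p.2.1)
        (Ioi 0 ×ˢ (Ioo 0 π ×ˢ Ioo 0 (2 * π))) := by
    intro u hu v hv
    have hv' : IntegrableOn (fun p : ℝ × ℝ => v p.1) (Ioo 0 π ×ˢ Ioo 0 (2 * π)) :=
      ((hv.comp continuous_fst).continuousOn.integrableOn_compact
        (isCompact_Icc.prod isCompact_Icc)).mono_set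
          (prod_mono Ioo_subset_Icc_self Ioo_subset_Icc_self)
    have := (hu.integrableOn t hα).integrable.mul_prod hv'.integrable
    rwa [Measure.prod_restrict] at this
  have h := ((((key _ (isJacobianCombination_densR hq α) (fun θ => 2 * sin θ ^ 3)
      (by fun_prop)).add (key _ (isJacobianCombination_angT hq α)
      (fun θ => sin θ * (1 + cos θ ^ 2)) (by fun_prop))).sub
      (key _ (isJacobianCombination_angR hq α) (fun θ => 2 * sin θ * cos θ)
      (by fun_prop))).const_mul (1 / (8 * π) * (-1)))
  refine IntegrableOn.congr_fun h (fun p hp => ?_)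
    (measurableSet_Ioi.prod (measurableSet_Ioo.prod measurableSet_Ioo))
  simp only [Pi.add_apply, Pi.sub_apply]
  rw [hopfionCurrent_zero hα hb t _ hp.1
    (sin_nonneg_of_nonneg_of_le_pi hp.2.1.1.le hp.2.1.2.le)]
  ring

theorem integrableOn_hopfionCurrent_one {α b : ℝ} (hα : 0 < α) (hb : b ≠ 0) (t : ℝ) {ρ : ℝ}
    (hρ : 0 < ρ) :
    IntegrableOn (fun p : ℝ × ℝ => hopfionCurrent α b t ρ p.1 p.2 1)
      (Ioo 0 π ×ˢ Ioo 0 (2 * π)) := by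
  have h : IntegrableOn (fun p : ℝ × ℝ => 1 / (8 * π)
      * (2 * sin p.1 ^ 3 * densT α (b * α) (flatR α t ρ) (flatT α t ρ)
        + sin p.1 * (1 + cos p.1 ^ 2) * angR α (b * α) (flatR α t ρ) (flatT α t ρ)
        - 2 * sin p.1 * cos p.1 * angT α (b * α) (flatR α t ρ) (flatT α t ρ)))
      (Ioo 0 π ×ˢ Ioo 0 (2 * π)) := by
    refine (Continuous.continuousOn (by fun_prop)).integrableOn_compact
      (isCompact_Icc.prod isCompact_Icc) |>.mono_set
        (prod_mono Ioo_subset_Icc_self Ioo_subset_Icc_self)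
  refine h.congr_fun (fun p hp => ?_) (measurableSet_Ioo.prod measurableSet_Ioo)
  exact (hopfionCurrent_one hα hb t _ hρ
    (sin_nonneg_of_nonneg_of_le_pi hp.1.1.le hp.1.2.le)).symm

/-! ### The flat limit. -/

theorem abs_arctan_sub_le (x : ℝ) : |arctan x - x| ≤ |x| ^ 3 := by
  have h := (convex_uIcc 0 x).norm_image_sub_le_of_norm_hasDerivWithin_le
    (f := fun y => arctan y - y) (f' := fun y => 1 / (1 + y ^ 2) - 1) (C := |x| ^ 2)
    (fun y _ => ((hasDerivAt_arctan y).sub (hasDerivAt_id y)).hasDerivWithinAt)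
    (fun y hy => ?_) left_mem_uIcc right_mem_uIcc
  · simpa [pow_succ] using h
  · have hy' : |y| ≤ |x| := by simpa using abs_sub_left_of_mem_uIcc hy
    have hp : 0 < 1 + y ^ 2 := by positivity
    have e : 1 / (1 + y ^ 2) - 1 = -(y ^ 2 / (1 + y ^ 2)) := by field_simp; ring
    rw [norm_eq_abs, e, abs_neg, abs_of_nonneg (by positivity)]
    calc y ^ 2 / (1 + y ^ 2) ≤ y ^ 2 := div_le_self (sq_nonneg y) (by nlinarith [sq_nonneg y])
      _ = |y| ^ 2 := (sq_abs y).symm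
      _ ≤ |x| ^ 2 := by gcongr

theorem arctan_one_div {x : ℝ} (hx : x ≠ 0) : arctan (1 / x) = π / 2 * sign x - arctan x := by
  rw [one_div]
  rcases hx.lt_or_gt with h | h
  · rw [arctan_inv_of_neg h, sign_of_neg h]; ring
  · rw [arctan_inv_of_pos h, sign_of_pos h]; ring

/-- With x = αb, the rational term x(1 - x²)/(1 + x²)² equals x - x³(3 + x²)/(1 + x²)², and its
linear part cancels that of -arctan x. -/
theorem helicityValue_sub {α b : ℝ} (hα : 0 < α) (hb : b ≠ 0) :
    helicityValue α b - π * Real.sign b / (16 * b ^ 4) = 1 / (8 * b ^ 4)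
      * (-(arctan (α * b) - α * b)
        - (α * b) ^ 3 * (3 + (α * b) ^ 2) / (1 + (α * b) ^ 2) ^ 2) := by
  have hs : sign (α * b) = sign b := by
    rcases hb.lt_or_gt with h | h
    · rw [sign_of_neg h, sign_of_neg (mul_neg_of_pos_of_neg hα h)]
    · rw [sign_of_pos h, sign_of_pos (mul_pos hα h)]
  rw [helicityValue, arctan_one_div (mul_ne_zero hα.ne' hb), hs]
  have hK : b ^ 2 * α ^ 2 + 1 ≠ 0 := by positivity
  have hK' : 1 + (α * b) ^ 2 ≠ 0 := by positivity
  field_simp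
  ring

theorem abs_helicityValue_sub_le {α b : ℝ} (hα : 0 < α) (hb : b ≠ 0) :
    |helicityValue α b - π * Real.sign b / (16 * b ^ 4)|
      ≤ 1 / (8 * b ^ 4) * (4 * |b| ^ 3) * α ^ 3 := by
  rw [helicityValue_sub hα hb, abs_mul, abs_of_nonneg (by positivity), mul_assoc]
  refine mul_le_mul_of_nonneg_left ?_ (by positivity)
  have h1 := abs_arctan_sub_le (α * b)
  have h2 : |(α * b) ^ 3 * (3 + (α * b) ^ 2) / (1 + (α * b) ^ 2) ^ 2| ≤ 3 * |α * b| ^ 3 := by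
    rw [abs_div, abs_mul, abs_pow, abs_of_nonneg (a := 3 + (α * b) ^ 2) (by positivity),
      abs_of_nonneg (a := (1 + (α * b) ^ 2) ^ 2) (by positivity), div_le_iff₀ (by positivity)]
    have : 3 + (α * b) ^ 2 ≤ 3 * (1 + (α * b) ^ 2) ^ 2 := by nlinarith [sq_nonneg (α * b)]
    calc |α * b| ^ 3 * (3 + (α * b) ^ 2)
        ≤ |α * b| ^ 3 * (3 * (1 + (α * b) ^ 2) ^ 2) := by gcongr
      _ = 3 * |α * b| ^ 3 * (1 + (α * b) ^ 2) ^ 2 := by ring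
  calc |-(arctan (α * b) - α * b) - (α * b) ^ 3 * (3 + (α * b) ^ 2) / (1 + (α * b) ^ 2) ^ 2|
      ≤ |-(arctan (α * b) - α * b)|
        + |(α * b) ^ 3 * (3 + (α * b) ^ 2) / (1 + (α * b) ^ 2) ^ 2| := abs_sub _ _
    _ ≤ |α * b| ^ 3 + 3 * |α * b| ^ 3 := by rw [abs_neg]; exact add_le_add h1 h2
    _ = 4 * |b| ^ 3 * α ^ 3 := by rw [abs_mul, abs_of_pos hα]; ring

theorem isBigO_totalHelicity {b : ℝ} (hb : b ≠ 0) (t : ℝ) :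
    (fun α => totalHelicity α b t - π * Real.sign b / (16 * b ^ 4))
      =O[𝓝[>] 0] (fun α => α ^ 3) := by
  refine IsBigO.of_bound (1 / (8 * b ^ 4) * (4 * |b| ^ 3)) ?_
  filter_upwards [self_mem_nhdsWithin] with α hα
  have hα' : 0 < α := hα
  rw [totalHelicity_eq hα hb, norm_eq_abs, norm_of_nonneg (by positivity)]
  exact abs_helicityValue_sub_le hα hb

end

end DeSitterHopfion

theorem mainTheorem7 (b : ℝ) (hb : b ≠ 0) :
    (∀ α : ℝ, 0 < α →
      -- the potential is smooth and `𝓕_H = d𝓐_H`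
      ContDiffOn ℝ ∞ (DeSitterHopfion.hopfionA α b) DeSitterHopfion.chart ∧
      (∀ x ∈ DeSitterHopfion.chart,
        DeSitterHopfion.extD (DeSitterHopfion.hopfionA α b) x = DeSitterHopfion.hopfionF α b x) ∧
      -- the total helicity: finiteness, closed form, independence of time
      (∀ t : ℝ,
        IntegrableOn
          (fun p : ℝ × ℝ × ℝ => DeSitterHopfion.hopfionCurrent α b t p.1 p.2.1 p.2.2 0)
          (Ioi 0 ×ˢ (Ioo 0 π ×ˢ Ioo 0 (2 * π))) ∧
        DeSitterHopfion.totalHelicity α b t = DeSitterHopfion.helicityValue α b ∧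
        HasDerivAt (fun s => DeSitterHopfion.totalHelicity α b s) 0 t ∧
        -- the flux through the cosmological horizon
        (∀ ρ : ℝ, 0 < ρ →
          IntegrableOn (fun p : ℝ × ℝ => DeSitterHopfion.hopfionCurrent α b t ρ p.1 p.2 1)
            (Ioo 0 π ×ˢ Ioo 0 (2 * π))) ∧
        Tendsto (fun ρ => DeSitterHopfion.helicityFlux α b t ρ) atTop (𝓝 0))) ∧
    -- the flat limit
    (∀ t : ℝ,
      Tendsto (fun α => DeSitterHopfion.totalHelicity α b t) (𝓝[>] 0)
        (𝓝 (π * Real.sign b / (16 * b ^ 4))) ∧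
      (fun α => DeSitterHopfion.totalHelicity α b t - π * Real.sign b / (16 * b ^ 4))
        =O[𝓝[>] 0] (fun α => α ^ 3)) := by
  refine ⟨fun α hα => ⟨(DeSitterHopfion.contDiff_hopfionA hα.ne' hb).contDiffOn,
    fun x hx => DeSitterHopfion.extD_hopfionA hα hb x hx.1, fun t =>
    ⟨DeSitterHopfion.integrableOn_hopfionCurrent_zero hα hb t,
      DeSitterHopfion.totalHelicity_eq hα hb t, ?_,
      fun ρ hρ => DeSitterHopfion.integrableOn_hopfionCurrent_one hα hb t hρ,
      DeSitterHopfion.tendsto_helicityFlux hα hb t⟩⟩, fun t => ⟨?_, ?_⟩⟩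
  · simp only [DeSitterHopfion.totalHelicity_eq hα hb]
    exact hasDerivAt_const _ _
  · have h3 : Tendsto (fun α : ℝ => α ^ 3) (𝓝[>] 0) (𝓝 0) :=
      (((continuous_pow 3).tendsto' (0 : ℝ) 0 (by simp))).mono_left nhdsWithin_le_nhds
    exact tendsto_sub_nhds_zero_iff.mp
      ((DeSitterHopfion.isBigO_totalHelicity hb t).trans_tendsto h3)
  · exact DeSitterHopfion.isBigO_totalHelicity hb t
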